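/- **Setting.** Let $N\ge 3$, $V_N=\mathbb C^N$ with the standard bilinear form $(x,y)=\sum_i x_iy_i$, and $\mathfrak{so}_N=\{A\in \mathrm{Mat}_N(\mathbb C): A^t=-A\}$, acting on $V_N$ by $x\mapsto Ax$. Identify $S(\mathfrak{so}_N)$ with the polynomial functions on $\mathfrak{so}_N$ through the trace form: $X\in\mathfrak{so}_N$ is the function $A\mapsto \mathrm{tr}(AX)$. The symmetrization is the linear map $S(\mathfrak{so}_N)\to U(\mathfrak{so}_N)$, $x_1\cdots x_n\mapsto \frac1{n!}\sum_{\sigma\in S_n}x_{\sigma(1)}\cdots x_{\sigma(n)}$. For a power series $T$ without constant term put $(1+T)^{\alpha}=\sum_{n\ge0}\frac{\alpha(\alpha-1)\cdots(\alpha-n+1)}{n!}T^n$. For $x,y\in V_N$ define $\gamma_{2j+1}(x,y)\in S(\mathfrak{so}_N)$ by $$(x,A(1+\tau^2A^2)^{-1}y)\,\det(1+\tau^2A^2)^{-1/2}=\sum_{j\ge0}\gamma_{2j+1}(x,y)(A)\,\tau^{2j},\qquad A\in\mathfrak{so}_N,$$ and let $r_{2j+1}(x,y)\in U(\mathfrak{so}_N)$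 be its symmetrization. For $m\ge 0$ and $\zeta=(\zeta_0,\dots,\zeta_m)\in\mathbb C^{m+1}$ let $H_\zeta(\mathfrak{so}_N,V_N)$ be the quotient of $U(\mathfrak{so}_N)\ltimes T(V_N)$ (the algebra generated by $U(\mathfrak{so}_N)$ and $V_N$ with $[A,x]=Ax$ for $A\in\mathfrak{so}_N$, $x\in V_N$) by the relations $$[x,y]=\sum_{j=0}^m\zeta_j\,r_{2j+1}(x,y),\qquad x,y\in V_N.$$ **Constants.** For $s\ge0$ let $$\omega_s=\frac{\pi^{1/2}(s+N-1)!}{2^{s+N+1}},\qquad \mu_s=\pi^{N-\frac12}(s+1)!\,\omega_s^{-1},\qquad \nu_s=-\frac{\mu_s}{s+1}.$$ Let $a_0,\dots,a_m$ be the unique complex numbers with $$\zeta_j=2\nu_{2j+1}\sum_{l=1}^{m+1-j}(-1)^{l+1}\binom{2j+2l}{2l-1}a_{j+l-1}\qquad(0\le j\le m),$$ and put $$g_j=2\mu_{2j-1}\Bigl(-2a_{j-1}+\sum_{l=1}^{m+1-j}(-1)^{l+1}\binom{2j+2l}{2l}a_{j+l-1}\Bigr)\quad(1\le j\le m+1),\qquad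 g(z)=\sum_{j=1}^{m+1}g_jz^j.$$ **Theorem.** Let $C\in U(\mathfrak{so}_N)$ be the symmetrization of the polynomial function $$A\mapsto \mathrm{Res}_{z=0}\ g(z^{-2})\det(1+z^2A^2)^{-1/2}z^{-1}\,dz .$$ Then $C$ is central in $U(\mathfrak{so}_N)$, and with $t_1=(v,v)=\sum_{i=1}^Nx_i^2$, where $x_1,\dots,x_N$ is the standard (orthonormal) basis of $V_N$, the element $t_1'=t_1+C$ is central in $H_\zeta(\mathfrak{so}_N,V_N)$. -/

import Mathlib

noncomputable section

namespace SoHecke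

open Matrix PowerSeries

attribute [local instance] LieRing.ofAssociativeRing

/-! ### Symmetrization -/

section Symmetrization

variable {L : Type*} [LieRing L] [LieAlgebra ℂ L]

/-- The symmetrized product `(x₁, …, xₙ) ↦ (1/n!) ∑_σ x_{σ(1)} ⋯ x_{σ(n)}` of elements of a Lie
algebra, with values in its universal enveloping algebra. -/
def symProd {n : ℕ} (x : Fin n → L) : UniversalEnvelopingAlgebra ℂ L :=
  ((n.factorial : ℂ)⁻¹) • ∑ σ : Equiv.Perm (Fin n),
    (List.ofFn fun i => UniversalEnvelopingAlgebra.ι ℂ (x (σ i))).prod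

/-- The symmetrization map `S(L) → U(L)`. It is written down on the monomials in a basis of `L`;
`symmetrization_prod` below gives the usual basis-free formula. -/
def symmetrization : SymmetricAlgebra ℂ L →ₗ[ℂ] UniversalEnvelopingAlgebra ℂ L :=
  (Module.Basis.ofVectorSpace ℂ L).symmetricAlgebra.constr ℂ fun s =>
    symProd fun i : Fin s.toMultiset.toList.length =>
      Module.Basis.ofVectorSpace ℂ L (s.toMultiset.toList.get i)

/-- The symmetrized product as a multilinear map. -/
def symProdMultilinear (L : Type*) [LieRing L] [LieAlgebra ℂ L] (n : ℕ) :
    MultilinearMap ℂ (fun _ : Fin n => L) (UniversalEnvelopingAlgebra ℂ L) :=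
  ((n.factorial : ℂ)⁻¹) • ∑ σ : Equiv.Perm (Fin n),
    (((MultilinearMap.mkPiAlgebraFin ℂ n (UniversalEnvelopingAlgebra ℂ L)).compLinearMap
      fun _ => (UniversalEnvelopingAlgebra.ι ℂ : L →ₗ⁅ℂ⁆ _).toLinearMap).domDomCongr σ)

theorem symProdMultilinear_apply {n : ℕ} (x : Fin n → L) :
    symProdMultilinear L n x = symProd x := by
  simp [symProdMultilinear, symProd]

theorem symProd_comp_perm {n : ℕ} (x : Fin n → L) (τ : Equiv.Perm (Fin n)) :
    symProd (x ∘ τ) = symProd x := by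
  unfold symProd
  congr 1
  exact Fintype.sum_equiv (Equiv.mulLeft τ) _ _ fun σ => by simp

theorem exists_equiv_of_map_eq {α : Type*} {n k : ℕ} (f : Fin n → α) (g : Fin k → α)
    (h : (Finset.univ : Finset (Fin n)).val.map f = (Finset.univ : Finset (Fin k)).val.map g) :
    ∃ e : Fin n ≃ Fin k, ∀ i, f i = g (e i) := by
  classical
  have hc : ∀ a, Nonempty ({i // f i = a} ≃ {i // g i = a}) := by
    intro a
    refine ⟨Fintype.equivOfCardEq ?_⟩
    have h' := congrArg (Multiset.count a) h
    rw [Multiset.count_map, Multiset.count_map] at h'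
    rw [Fintype.card_subtype, Fintype.card_subtype]
    simpa [Finset.card, eq_comm] using h'
  let e' := fun a => (hc a).some
  refine ⟨(Equiv.sigmaFiberEquiv f).symm.trans
    ((Equiv.sigmaCongrRight e').trans (Equiv.sigmaFiberEquiv g)), fun i => ?_⟩
  exact ((e' (f i)) ⟨i, rfl⟩).2.symm

theorem symProd_eq_of_map_eq {α : Type*} {n k : ℕ} (b : α → L) (f : Fin n → α) (g : Fin k → α)
    (h : (Finset.univ : Finset (Fin n)).val.map f = (Finset.univ : Finset (Fin k)).val.map g) :
    symProd (fun i => b (f i)) = symProd fun i => b (g i) := by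
  obtain ⟨e, he⟩ := exists_equiv_of_map_eq f g h
  obtain rfl : n = k := by simpa using Fintype.card_congr e
  have : (fun i => b (f i)) = (fun i => b (g i)) ∘ e := by
    funext i
    simp [he i]
  rw [this, symProd_comp_perm]

/-- `symmetrization (x₁ ⋯ xₙ) = (1/n!) ∑_σ x_{σ(1)} ⋯ x_{σ(n)}` for all `x₁, …, xₙ ∈ L`. -/
theorem symmetrization_prod {n : ℕ} (x : Fin n → L) :
    symmetrization (∏ i, SymmetricAlgebra.ι ℂ L (x i)) = symProd x := by
  have key : symmetrization.compMultilinearMap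
      ((MultilinearMap.mkPiAlgebra ℂ (Fin n) (SymmetricAlgebra ℂ L)).compLinearMap
        fun _ => SymmetricAlgebra.ι ℂ L) = symProdMultilinear L n := by
    refine Module.Basis.ext_multilinear (fun _ => Module.Basis.ofVectorSpace ℂ L) fun v => ?_
    rw [symProdMultilinear_apply]
    have h1 : (∏ i, SymmetricAlgebra.ι ℂ L (Module.Basis.ofVectorSpace ℂ L (v i))) =
        (Module.Basis.ofVectorSpace ℂ L).symmetricAlgebra (∑ i, Finsupp.single (v i) 1) := by
      rw [Module.Basis.symmetricAlgebra, Module.Basis.map_apply, MvPolynomial.coe_basisMonomials]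
      beta_reduce
      rw [MvPolynomial.monomial_sum_one]
      simp only [AlgEquiv.toLinearEquiv_apply, map_prod]
      exact Finset.prod_congr rfl fun i _ =>
        (SymmetricAlgebra.equivMvPolynomial_symm_X _ _).symm
    simp only [LinearMap.compMultilinearMap_apply, MultilinearMap.compLinearMap_apply,
      MultilinearMap.mkPiAlgebra_apply]
    rw [h1, symmetrization, Module.Basis.constr_basis]
    apply symProd_eq_of_map_eq (Module.Basis.ofVectorSpace ℂ L)
    have h2 : ∀ l : List (Module.Basis.ofVectorSpaceIndex ℂ L),
        (Finset.univ : Finset (Fin l.length)).val.map l.get = (l : Multiset _) := fun l => by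
      simp [Fin.univ_def]
    rw [h2, Multiset.coe_toList, map_sum]
    simp only [Finsupp.toMultiset_single, one_smul]
    rw [Finset.sum]
    exact (congrArg Multiset.sum (Multiset.map_map (fun a => ({a} : Multiset _)) v _).symm).trans
      (Multiset.sum_map_singleton _)
  have := congrArg (fun F => F x) key
  simpa [symProdMultilinear_apply] using this

end Symmetrization

/-! ### Formal power series attached to a matrix -/

section Series

variable {R : Type*} [CommRing R] {N : ℕ}

/-- `(1 + T)^α = ∑ₙ (α (α - 1) ⋯ (α - n + 1) / n!) Tⁿ`, for a power series `T` without constant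
term. -/
def onePlusPow [Algebra ℂ R] (α : ℂ) (T : R⟦X⟧) : R⟦X⟧ :=
  (PowerSeries.binomialSeries ℂ α).subst T

theorem onePlusPow_neg_half_sq [Algebra ℂ R] {T : R⟦X⟧} (hT : constantCoeff T = 0) :
    onePlusPow (-1 / 2) T ^ 2 * (1 + T) = 1 := by
  have hs : HasSubst T := HasSubst.of_constantCoeff_zero' hT
  have h1 : (PowerSeries.binomialSeries ℂ (-1 / 2 : ℂ)) ^ 2 * (1 + X) = 1 := by
    have h2 : (1 + X : ℂ⟦X⟧) = PowerSeries.binomialSeries ℂ (1 : ℂ) := by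
      simpa using (binomialSeries_nat (R := ℂ) (A := ℂ) 1).symm
    rw [h2, pow_two, ← binomialSeries_add, ← binomialSeries_add]
    norm_num
  have h3 := congrArg (PowerSeries.subst T) h1
  rw [subst_mul hs, subst_pow hs, subst_add hs, subst_X hs] at h3
  have h4 : PowerSeries.subst T (1 : ℂ⟦X⟧) = (1 : R⟦X⟧) := by
    rw [← coe_substAlgHom hs, map_one]
  rw [h4] at h3
  exact h3

/-- The matrix `1 + τ² A²`, where `τ` is the power series variable. -/
def onePlusSq (A : Matrix (Fin N) (Fin N) R) : Matrix (Fin N) (Fin N) R⟦X⟧ :=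
  1 + (X : R⟦X⟧) ^ 2 • (A.map (C : R →+* R⟦X⟧)) ^ 2

theorem constantCoeff_det_onePlusSq (A : Matrix (Fin N) (Fin N) R) :
    constantCoeff (onePlusSq A).det = 1 := by
  rw [RingHom.map_det]
  have : (constantCoeff (R := R)).mapMatrix (onePlusSq A) = 1 := by
    rw [onePlusSq, map_add, map_one]
    ext i j
    simp [RingHom.mapMatrix_apply]
  rw [this, Matrix.det_one]

/-- `det(1 + τ² A²)^(-1/2)`. -/
def detInvSqrt [Algebra ℂ R] (A : Matrix (Fin N) (Fin N) R) : R⟦X⟧ :=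
  onePlusPow (-1 / 2) ((onePlusSq A).det - 1)

/-- `(x, A (1 + τ² A²)⁻¹ y) det(1 + τ² A²)^(-1/2)`, where `(·,·)` is the standard bilinear form on
column vectors. -/
def resolventSeries [Algebra ℂ R] (A : Matrix (Fin N) (Fin N) R) (x y : Fin N → ℂ) : R⟦X⟧ :=
  ((fun i => algebraMap ℂ R⟦X⟧ (x i)) ⬝ᵥ
    ((A.map (C : R →+* R⟦X⟧) * (onePlusSq A)⁻¹) *ᵥ fun i => algebraMap ℂ R⟦X⟧ (y i))) *
      detInvSqrt A

section Naturality

variable [Algebra ℂ R] {S : Type*} [CommRing S] [Algebra ℂ S]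

theorem map_onePlusPow (f : R →ₐ[ℂ] S) (α : ℂ) {T : R⟦X⟧} (hT : constantCoeff T = 0) :
    PowerSeries.map (f : R →+* S) (onePlusPow α T) =
      onePlusPow α (PowerSeries.map (f : R →+* S) T) := by
  have hs : HasSubst T := HasSubst.of_constantCoeff_zero' hT
  have hs' : HasSubst (PowerSeries.map (f : R →+* S) T) :=
    HasSubst.of_constantCoeff_zero' (by
      rw [← coeff_zero_eq_constantCoeff_apply, coeff_map, coeff_zero_eq_constantCoeff_apply, hT,
        map_zero])
  ext n
  rw [coeff_map, onePlusPow, onePlusPow, coeff_subst' hs, coeff_subst' hs']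
  have hf := coeff_subst_finite' hs (PowerSeries.binomialSeries ℂ α) n
  have h := AddMonoidHom.map_finsum (f : R →+ S) hf
  refine Eq.trans h (finsum_congr fun d => ?_)
  rw [← map_pow, coeff_map]
  exact map_smul f _ _

theorem map_onePlusSq (f : R →ₐ[ℂ] S) (A : Matrix (Fin N) (Fin N) R) :
    (PowerSeries.map (f : R →+* S)).mapMatrix (onePlusSq A) = onePlusSq (A.map f) := by
  rw [onePlusSq, onePlusSq, map_add, map_one]
  congr 1
  have h : (PowerSeries.map (f : R →+* S)).mapMatrix (A.map (C : R →+* R⟦X⟧)) =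
      (A.map f).map (C : S →+* S⟦X⟧) := by
    ext i j : 2
    simp [RingHom.mapMatrix_apply]
  rw [← h, ← map_pow]
  ext i j : 2
  simp [RingHom.mapMatrix_apply]

theorem map_detInvSqrt (f : R →ₐ[ℂ] S) (A : Matrix (Fin N) (Fin N) R) :
    PowerSeries.map (f : R →+* S) (detInvSqrt A) = detInvSqrt (A.map f) := by
  rw [detInvSqrt, map_onePlusPow f _ (by rw [map_sub, constantCoeff_det_onePlusSq]; simp),
    detInvSqrt, map_sub, map_one, RingHom.map_det, map_onePlusSq]

theorem map_resolventSeries (f : R →ₐ[ℂ] S) (A : Matrix (Fin N) (Fin N) R) (x y : Fin N → ℂ) :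
    PowerSeries.map (f : R →+* S) (resolventSeries A x y) = resolventSeries (A.map f) x y := by
  have hinv : (PowerSeries.map (f : R →+* S)).mapMatrix (onePlusSq A)⁻¹ =
      (onePlusSq (A.map f))⁻¹ := by
    symm
    apply Matrix.inv_eq_right_inv
    rw [← map_onePlusSq, ← map_mul, Matrix.mul_nonsing_inv, map_one]
    rw [isUnit_iff_constantCoeff, constantCoeff_det_onePlusSq]
    exact isUnit_one
  have hC : (PowerSeries.map (f : R →+* S)).mapMatrix (A.map (C : R →+* R⟦X⟧)) =
      (A.map f).map (C : S →+* S⟦X⟧) := by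
    ext i j : 2
    simp [RingHom.mapMatrix_apply]
  have halg : ∀ c : ℂ, PowerSeries.map (f : R →+* S) (algebraMap ℂ R⟦X⟧ c) =
      algebraMap ℂ S⟦X⟧ c := fun c => by
    rw [PowerSeries.algebraMap_apply, PowerSeries.algebraMap_apply, map_C]
    simp
  rw [resolventSeries, resolventSeries, map_mul, map_detInvSqrt, RingHom.map_dotProduct]
  congr 2
  · funext i
    exact halg _
  · funext i
    rw [Function.comp_apply, RingHom.map_mulVec, ← RingHom.mapMatrix_apply, map_mul, hinv, hC]
    congr 2
    funext i
    exact halg _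

end Naturality

/-- `Res_{z = 0} f(z) dz`. -/
def residue (f : LaurentSeries R) : R := f.coeff (-1)

end Series

/-! ### The orthogonal Lie algebra and its symmetric algebra -/

/-- `𝔰𝔬_N`, the skew-symmetric complex matrices. -/
abbrev soN (N : ℕ) : LieSubalgebra ℂ (Matrix (Fin N) (Fin N) ℂ) :=
  LieAlgebra.Orthogonal.so (Fin N) ℂ

/-- `V_N`, the column vectors of length `N`. -/
abbrev VN (N : ℕ) : Type := Fin N → ℂ

/-- The identification of `S(𝔰𝔬_N)` with the polynomial functions on `𝔰𝔬_N` through the trace form: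
`X ∈ 𝔰𝔬_N` is the function `A ↦ tr(A X)`. -/
def evalAt (N : ℕ) (A : Matrix (Fin N) (Fin N) ℂ) : SymmetricAlgebra ℂ (soN N) →ₐ[ℂ] ℂ :=
  SymmetricAlgebra.lift
    (Matrix.traceLinearMap (Fin N) ℂ ℂ ∘ₗ LinearMap.mulLeft ℂ A ∘ₗ (soN N).toSubmodule.subtype)

/-- The element `(E_{ji} - E_{ij}) / 2` of `𝔰𝔬_N`. -/
def coord (N : ℕ) (i j : Fin N) : soN N :=
  ⟨(1 / 2 : ℂ) • (Matrix.single j i 1 - Matrix.single i j 1), by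
    rw [LieAlgebra.Orthogonal.mem_so]
    simp [← smul_neg]⟩

/-- The universal matrix `A` over `S(𝔰𝔬_N) = ℂ[𝔰𝔬_N]`: its `(i, j)` entry is the `(i, j)` coordinate
function on `𝔰𝔬_N` (see `evalAt_genericMatrix`). -/
def genericMatrix (N : ℕ) : Matrix (Fin N) (Fin N) (SymmetricAlgebra ℂ (soN N)) :=
  Matrix.of fun i j => SymmetricAlgebra.ι ℂ (soN N) (coord N i j)

theorem evalAt_genericMatrix (N : ℕ) (A : soN N) (i j : Fin N) :
    evalAt N A (genericMatrix N i j) = (A : Matrix (Fin N) (Fin N) ℂ) i j := by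
  have h : (A : Matrix (Fin N) (Fin N) ℂ)ᵀ = -A := (LieAlgebra.Orthogonal.mem_so _ _ _).1 A.2
  have h' := congrFun (congrFun h i) j
  simp only [Matrix.transpose_apply, Matrix.neg_apply] at h'
  have h2 : evalAt N A (genericMatrix N i j) =
      ((A : Matrix (Fin N) (Fin N) ℂ) * (coord N i j : Matrix (Fin N) (Fin N) ℂ)).trace := by
    rw [genericMatrix, Matrix.of_apply, evalAt, SymmetricAlgebra.lift_ι_apply]
    rfl
  rw [h2]
  simp [coord, mul_sub, Matrix.trace_sub, Matrix.trace_mul_single, h']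
  ring

theorem map_genericMatrix (N : ℕ) (A : soN N) :
    (genericMatrix N).map (evalAt N A) = (A : Matrix (Fin N) (Fin N) ℂ) := by
  ext i j
  exact evalAt_genericMatrix N A i j

/-- `γ_{2j+1}(x, y) ∈ S(𝔰𝔬_N)`, the coefficient of `τ^(2j)` in
`(x, A (1 + τ² A²)⁻¹ y) det(1 + τ² A²)^(-1/2)`. -/
def gammaOdd (N j : ℕ) (x y : VN N) : SymmetricAlgebra ℂ (soN N) :=
  coeff (2 * j) (resolventSeries (genericMatrix N) x y)

/-- As a polynomial function of `A ∈ 𝔰𝔬_N`, `γ_{2j+1}(x, y)` is the coefficient of `τ^(2j)` in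
`(x, A (1 + τ² A²)⁻¹ y) det(1 + τ² A²)^(-1/2)`. -/
theorem evalAt_gammaOdd (N j : ℕ) (x y : VN N) (A : soN N) :
    evalAt N A (gammaOdd N j x y) =
      coeff (2 * j) (resolventSeries (A : Matrix (Fin N) (Fin N) ℂ) x y) := by
  conv_rhs => rw [← map_genericMatrix N A, ← map_resolventSeries, coeff_map]
  rfl

/-- `r_{2j+1}(x, y) ∈ U(𝔰𝔬_N)`. -/
def rOdd (N j : ℕ) (x y : VN N) : UniversalEnvelopingAlgebra ℂ (soN N) :=
  symmetrization (gammaOdd N j x y)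

/-- The pairing `κ = ∑_{j = 0}^m ζ_j r_{2j+1}`. Only `ζ_0, …, ζ_m` enter. -/
def kappa (N m : ℕ) (ζ : ℕ → ℂ) (x y : VN N) : UniversalEnvelopingAlgebra ℂ (soN N) :=
  ∑ j ∈ Finset.range (m + 1), ζ j • rOdd N j x y

/-! ### The algebra `H_ζ(𝔰𝔬_N, V_N)` -/

/-- The defining relations of `U(𝔰𝔬_N) ⋉ T V_N` inside the tensor algebra of `𝔰𝔬_N ⊕ V_N`. -/
inductive SmashRel (N : ℕ) :
    TensorAlgebra ℂ (soN N × VN N) → TensorAlgebra ℂ (soN N × VN N) → Prop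
  | lie (A B : soN N) : SmashRel N
      (TensorAlgebra.ι ℂ (A, 0) * TensorAlgebra.ι ℂ (B, 0) -
        TensorAlgebra.ι ℂ (B, 0) * TensorAlgebra.ι ℂ (A, 0))
      (TensorAlgebra.ι ℂ (⁅A, B⁆, 0))
  | act (A : soN N) (x : VN N) : SmashRel N
      (TensorAlgebra.ι ℂ (A, 0) * TensorAlgebra.ι ℂ (0, x) -
        TensorAlgebra.ι ℂ (0, x) * TensorAlgebra.ι ℂ (A, 0))
      (TensorAlgebra.ι ℂ (0, (A : Matrix (Fin N) (Fin N) ℂ) *ᵥ x))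

/-- `U(𝔰𝔬_N) ⋉ T V_N`. -/
abbrev Smash (N : ℕ) : Type := RingQuot (SmashRel N)

/-- The inclusion of the generators `V_N` in `U(𝔰𝔬_N) ⋉ T V_N`. -/
def smashVec (N : ℕ) : VN N →ₗ[ℂ] Smash N :=
  (RingQuot.mkAlgHom ℂ (SmashRel N)).toLinearMap ∘ₗ TensorAlgebra.ι ℂ ∘ₗ
    LinearMap.inr ℂ (soN N) (VN N)

/-- The inclusion of the generators `𝔰𝔬_N` in `U(𝔰𝔬_N) ⋉ T V_N`. -/
def smashLie (N : ℕ) : soN N →ₗ⁅ℂ⁆ Smash N :=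
  { (RingQuot.mkAlgHom ℂ (SmashRel N)).toLinearMap ∘ₗ TensorAlgebra.ι ℂ ∘ₗ
      LinearMap.inl ℂ (soN N) (VN N) with
    map_lie' := by
      intro A B
      have h := RingQuot.mkAlgHom_rel ℂ (SmashRel.lie A B)
      rw [map_sub, map_mul, map_mul] at h
      exact h.symm }

/-- The map `U(𝔰𝔬_N) → U(𝔰𝔬_N) ⋉ T V_N`. -/
def smashU (N : ℕ) : UniversalEnvelopingAlgebra ℂ (soN N) →ₐ[ℂ] Smash N :=
  UniversalEnvelopingAlgebra.lift ℂ (smashLie N)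

/-- The relations `[x, y] = κ(x, y)` for `x, y ∈ V_N`. -/
inductive HeckeRel (N m : ℕ) (ζ : ℕ → ℂ) : Smash N → Smash N → Prop
  | comm (x y : VN N) : HeckeRel N m ζ
      (smashVec N x * smashVec N y - smashVec N y * smashVec N x)
      (smashU N (kappa N m ζ x y))

/-- The infinitesimal Hecke algebra
`H_ζ(𝔰𝔬_N, V_N) = U(𝔰𝔬_N) ⋉ T V_N / ([x, y] - ∑_{j = 0}^m ζ_j r_{2j+1}(x, y))`. -/
abbrev HeckeAlg (N m : ℕ) (ζ : ℕ → ℂ) : Type := RingQuot (HeckeRel N m ζ)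

/-- The map `V_N → H_ζ(𝔰𝔬_N, V_N)`. -/
def heckeVec (N m : ℕ) (ζ : ℕ → ℂ) : VN N →ₗ[ℂ] HeckeAlg N m ζ :=
  (RingQuot.mkAlgHom ℂ (HeckeRel N m ζ)).toLinearMap ∘ₗ smashVec N

/-- The map `U(𝔰𝔬_N) → H_ζ(𝔰𝔬_N, V_N)`. -/
def heckeU (N m : ℕ) (ζ : ℕ → ℂ) :
    UniversalEnvelopingAlgebra ℂ (soN N) →ₐ[ℂ] HeckeAlg N m ζ :=
  (RingQuot.mkAlgHom ℂ (HeckeRel N m ζ)).comp (smashU N)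

/-- `t_1 = (v, v) = ∑ᵢ xᵢ²` for the orthonormal basis `x₁, …, x_N` of `V_N`. -/
def tOne (N m : ℕ) (ζ : ℕ → ℂ) : HeckeAlg N m ζ :=
  ∑ i : Fin N, heckeVec N m ζ (Pi.single i 1) ^ 2

/-! ### The constants and the correction term -/

/-- `ω_s = π^(1/2) (s + N - 1)! / 2^(s + N + 1)`. -/
def omegaC (N s : ℕ) : ℝ :=
  Real.pi ^ (1 / 2 : ℝ) * ((s + N - 1).factorial : ℝ) / 2 ^ (s + N + 1)

/-- `μ_s = π^(N - 1/2) (s + 1)! ω_s⁻¹`. -/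
def muC (N s : ℕ) : ℝ :=
  Real.pi ^ ((N : ℝ) - 1 / 2) * ((s + 1).factorial : ℝ) * (omegaC N s)⁻¹

/-- `ν_s = - μ_s / (s + 1)`. -/
def nuC (N s : ℕ) : ℝ := -(muC N s) / ((s : ℝ) + 1)

theorem nuC_ne_zero (N s : ℕ) : nuC N s ≠ 0 := by
  have h1 : omegaC N s ≠ 0 := by unfold omegaC; positivity
  have h2 : muC N s ≠ 0 := by unfold muC; positivity
  have h3 : (s : ℝ) + 1 ≠ 0 := by positivity
  exact div_ne_zero (neg_ne_zero.2 h2) h3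

/-- The coefficients `a_0, …, a_m`, solved for in the recursion `aSeq_recursion`, starting from
`a_m` and going down. -/
def aSeq (N m : ℕ) (ζ : ℕ → ℂ) (j : ℕ) : ℂ :=
  (ζ j / (2 * (nuC N (2 * j + 1) : ℂ)) -
    ∑ i : Fin (m - j), (-1) ^ ((i : ℕ) + 3) *
      (Nat.choose (2 * j + 2 * ((i : ℕ) + 2)) (2 * ((i : ℕ) + 2) - 1) : ℂ) *
        aSeq N m ζ (j + (i : ℕ) + 1)) / (2 * j + 2)
termination_by m - j
decreasing_by
  have := i.isLt
  omega

/-- The defining recursion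
`ζ_j = 2 ν_{2j+1} ∑_{l = 1}^{m + 1 - j} (-1)^(l + 1) binom(2j + 2l, 2l - 1) a_{j + l - 1}`,
`0 ≤ j ≤ m`. -/
theorem aSeq_recursion (N m : ℕ) (ζ : ℕ → ℂ) (j : ℕ) (hj : j ≤ m) :
    ζ j = 2 * (nuC N (2 * j + 1) : ℂ) * ∑ l ∈ Finset.Icc 1 (m + 1 - j),
      (-1) ^ (l + 1) * (Nat.choose (2 * j + 2 * l) (2 * l - 1) : ℂ) *
        aSeq N m ζ (j + l - 1) := by
  have hν : (nuC N (2 * j + 1) : ℂ) ≠ 0 := by exact_mod_cast nuC_ne_zero N (2 * j + 1)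
  have hj2 : (2 * (j : ℂ) + 2) ≠ 0 := by exact_mod_cast (by omega : 2 * j + 2 ≠ 0)
  have hsum : ∑ l ∈ Finset.Icc 1 (m + 1 - j),
      (-1 : ℂ) ^ (l + 1) * (Nat.choose (2 * j + 2 * l) (2 * l - 1) : ℂ) *
        aSeq N m ζ (j + l - 1) =
      (2 * j + 2) * aSeq N m ζ j + ∑ i : Fin (m - j), (-1) ^ ((i : ℕ) + 3) *
      (Nat.choose (2 * j + 2 * ((i : ℕ) + 2)) (2 * ((i : ℕ) + 2) - 1) : ℂ) *
        aSeq N m ζ (j + (i : ℕ) + 1) := by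
    rw [Fin.sum_univ_eq_sum_range (fun i => (-1 : ℂ) ^ (i + 3) *
      (Nat.choose (2 * j + 2 * (i + 2)) (2 * (i + 2) - 1) : ℂ) * aSeq N m ζ (j + i + 1)) (m - j)]
    rw [← Finset.Ico_succ_right_eq_Icc, Finset.sum_Ico_eq_sum_range]
    have : Order.succ (m + 1 - j) - 1 = (m - j) + 1 := by
      rw [Nat.succ_eq_succ]; omega
    rw [this, Finset.sum_range_succ']
    rw [add_comm]
    congr 1
    · simp
    · refine Finset.sum_congr rfl fun i _ => ?_
      have e1 : 1 + (i + 1) = i + 2 := by omega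
      have e2 : j + (i + 2) - 1 = j + i + 1 := by omega
      rw [e1, e2]
  rw [hsum]
  rw [show aSeq N m ζ j = _ from aSeq.eq_1 N m ζ j]
  field_simp
  ring

/-- `g_j = 2 μ_{2j-1} (-2 a_{j-1} + ∑_{l = 1}^{m + 1 - j} (-1)^(l + 1) binom(2j + 2l, 2l) a_{j+l-1})`,
for `1 ≤ j ≤ m + 1`. -/
def gCoeff (N m : ℕ) (ζ : ℕ → ℂ) (j : ℕ) : ℂ :=
  2 * (muC N (2 * j - 1) : ℂ) * (-2 * aSeq N m ζ (j - 1) +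
    ∑ l ∈ Finset.Icc 1 (m + 1 - j),
      (-1) ^ (l + 1) * (Nat.choose (2 * j + 2 * l) (2 * l) : ℂ) * aSeq N m ζ (j + l - 1))

/-- `g(z) = ∑_{j = 1}^{m + 1} g_j z^j`. -/
def gPoly (N m : ℕ) (ζ : ℕ → ℂ) : Polynomial ℂ :=
  ∑ j ∈ Finset.Icc 1 (m + 1), Polynomial.monomial j (gCoeff N m ζ j)

/-- `Res_{z = 0} g(z⁻²) det(1 + z² A²)^(-1/2) z⁻¹ dz ∈ S(𝔰𝔬_N)`. -/
def casimirSymbol (N m : ℕ) (ζ : ℕ → ℂ) : SymmetricAlgebra ℂ (soN N) :=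
  residue
    (Polynomial.eval₂
        ((HahnSeries.C : SymmetricAlgebra ℂ (soN N) →+* LaurentSeries _).comp (algebraMap ℂ _))
        (HahnSeries.single (-2 : ℤ) 1) (gPoly N m ζ) *
      HahnSeries.ofPowerSeries ℤ (SymmetricAlgebra ℂ (soN N)) (detInvSqrt (genericMatrix N)) *
      HahnSeries.single (-1 : ℤ) 1)

/-- As a polynomial function of `A ∈ 𝔰𝔬_N`, the symbol is
`∑_{j = 1}^{m + 1} g_j [z^(2j)] det(1 + z² A²)^(-1/2)`. -/
theorem evalAt_casimirSymbol (N m : ℕ) (ζ : ℕ → ℂ) (A : soN N) :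
    evalAt N A (casimirSymbol N m ζ) = ∑ j ∈ Finset.Icc 1 (m + 1),
      gCoeff N m ζ j * coeff (2 * j) (detInvSqrt (A : Matrix (Fin N) (Fin N) ℂ)) := by
  have h : casimirSymbol N m ζ = ∑ j ∈ Finset.Icc 1 (m + 1),
      gCoeff N m ζ j • coeff (2 * j) (detInvSqrt (genericMatrix N)) := by
    rw [casimirSymbol, residue, gPoly, Polynomial.eval₂_finsetSum, Finset.sum_mul,
      Finset.sum_mul, HahnSeries.coeff_sum]
    refine Finset.sum_congr rfl fun j _ => ?_
    rw [Polynomial.eval₂_monomial, HahnSeries.single_pow, one_pow, RingHom.comp_apply,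
      HahnSeries.C_apply, HahnSeries.single_mul_single, zero_add, mul_one,
      HahnSeries.coeff_mul_single, HahnSeries.coeff_single_mul, mul_one,
      show (-1 : ℤ) - -1 - j • -2 = ((2 * j : ℕ) : ℤ) by push_cast; rw [nsmul_eq_mul]; ring,
      HahnSeries.ofPowerSeries_apply_coeff, Algebra.smul_def]
  rw [h, map_sum]
  refine Finset.sum_congr rfl fun j _ => ?_
  rw [map_smul, smul_eq_mul]
  conv_rhs => rw [← map_genericMatrix, ← map_detInvSqrt, coeff_map]
  rfl

/-- `C ∈ U(𝔰𝔬_N)`. -/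
def casimirC (N m : ℕ) (ζ : ℕ → ℂ) : UniversalEnvelopingAlgebra ℂ (soN N) :=
  symmetrization (casimirSymbol N m ζ)

end SoHecke

end

/-!
Let `P = ℂ[z, w]`, for two vectors `z`, `w` of `N` variables, and let `E : P → ℂ` be the Gaussian
functional `z^α w^β ↦ δ_{αβ} α!` (`gauss`), extended to polynomials with coefficients in any algebra.
It is characterised by integration by parts: `zᵢ` is adjoint to `∂/∂wᵢ`, and `wᵢ` to `∂/∂zᵢ`.

**Symbols as moments.** For a matrix `A` put `X = ∑ wᵢ Aᵢⱼ zⱼ`. Integration by parts gives the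
differential equation of `det(1 - sA)⁻¹` for the series `∑ E[Xⁿ] sⁿ / n!`, so the two agree
(`momentSeries_mul_det`). If `A` is skew-symmetric, then `det(1 + τ²A²)` is the square of
`det(1 - iτA)`, so the coefficients of `det(1 + τ²A²)^(-1/2)` are, up to explicit factors, the moments
`E[X^(2j)]` (`coeff_detInvSqrt`); those of the resolvent series are the moments of
`((w, y)(z, x) - (w, x)(z, y)) X^(2j+1)` (`coeff_resolventSeries`). The moment of a power of a linear
form is already symmetric, so symmetrization just replaces the generators of `S(𝔰𝔬_N)` by those of
`U(𝔰𝔬_N)` (`symmetrization_gaussExt`). From here on `X` has coefficients in `U(𝔰𝔬_N)`: it is the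
universal bivector `z ∧ w`.

**Invariance.** The adjoint action of `𝔰𝔬_N` on `X` is the action on the variables, under which `E` is
invariant. Hence `C`, a combination of the `E[X^(2j)]`, is central in `U(𝔰𝔬_N)`
(`casimirC_mem_center`).

**Commutators with a vector `y`.** Let `u = [X, y]`. As `z ∧ w` acts on the plane spanned by `z` and
`w` with a scalar square, `[X, [X, u]] = λu`, with `λ = ¼ ((z, w)² - (z, z)(w, w))`
(`bivAct_bivAct_bivAct`). On functions `F` of degree `d` in the bivector,
`E[λF] = ¼ (N + d)(N + d - 1) E[F]` (`IsBivectorial.gaussExt_bivNorm_smul`), as if `λ` were the number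
`1`, up to the normalization `c_d = (N + d - 2)! / 2^d`. Let `S` be half the anticommutator with `X`,
and let `φ` be the linear functional `s^k ↦ E[S^k u] / c_{k+1}` on `ℂ[s]`. Expanding left and right
multiplication by `X` as `S ± ½ [X, ·]` then gives
* `E[[Xⁿ, y]] = c_n φ((s + ½)ⁿ - (s - ½)ⁿ)` (`map_pow_mul_sub`),
* `E[Xⁿ u + u Xⁿ] = c_{n+1} φ((s + ½)ⁿ + (s - ½)ⁿ)` (`map_pow_mul_add`).

The first computes `[C, y]`, and the second `[t₁, y] = ∑ (xᵢ [xᵢ, y] + [xᵢ, y] xᵢ)`. With the given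
constants the normalizations `c_n` cancel, and the coefficient of each `a_{q-1}` vanishes by the
binomial theorem, for `P = s + ½` and `Q = s - ½`: `(1 - P)^(2q) - (1 + Q)^(2q) = Q^(2q) - P^(2q)`
(`binomial_difference`).
-/

noncomputable section

namespace SoHecke

open Matrix
open scoped TensorProduct

/-! ### The Gaussian functional -/

/-- Polynomials in two vectors `z = (z₁, …, z_N)` and `w = (w₁, …, w_N)` of commuting variables. -/
abbrev PairPoly (N : ℕ) : Type := MvPolynomial (Fin N ⊕ Fin N) ℂ

/-- The variable `zᵢ`. -/
def zVar {N : ℕ} (i : Fin N) : PairPoly N := MvPolynomial.X (Sum.inl i)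

/-- The variable `wᵢ`. -/
def wVar {N : ℕ} (i : Fin N) : PairPoly N := MvPolynomial.X (Sum.inr i)

/-- The partial derivative `∂/∂zᵢ`. -/
def dz {N : ℕ} (i : Fin N) : Derivation ℂ (PairPoly N) (PairPoly N) :=
  MvPolynomial.pderiv (Sum.inl i)

/-- The partial derivative `∂/∂wᵢ`. -/
def dw {N : ℕ} (i : Fin N) : Derivation ℂ (PairPoly N) (PairPoly N) :=
  MvPolynomial.pderiv (Sum.inr i)

section Variables

variable {N : ℕ} (i j : Fin N)

@[simp] theorem dz_zVar : dz i (zVar j) = if i = j then 1 else 0 := by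
  simp [dz, zVar, MvPolynomial.pderiv_X, Pi.single_apply, eq_comm]

@[simp] theorem dz_wVar : dz i (wVar j) = 0 := by
  simp [dz, wVar, MvPolynomial.pderiv_X]

@[simp] theorem dw_wVar : dw i (wVar j) = if i = j then 1 else 0 := by
  simp [dw, wVar, MvPolynomial.pderiv_X, Pi.single_apply, eq_comm]

@[simp] theorem dw_zVar : dw i (zVar j) = 0 := by
  simp [dw, zVar, MvPolynomial.pderiv_X]

end Variables

open scoped Classical in
/-- The value `δ_{αβ} α!` of the Gaussian functional on the monomial `z^α w^β`. -/
def gaussMonomial {N : ℕ} (s : Fin N ⊕ Fin N →₀ ℕ) : ℂ :=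
  if ∀ i, s (Sum.inl i) = s (Sum.inr i) then ∏ i, ((s (Sum.inl i)).factorial : ℂ) else 0

/-- The Gaussian functional `f ↦ ∫ f(z, z̄) dμ(z)`, for the Gaussian probability measure `μ` on
`ℂ^N` with density proportional to `exp(-|z|²)`, in its algebraic form `z^α w^β ↦ δ_{αβ} α!`. -/
def gauss (N : ℕ) : PairPoly N →ₗ[ℂ] ℂ :=
  (MvPolynomial.basisMonomials _ ℂ).constr ℂ gaussMonomial

section Gauss

variable {N : ℕ}

theorem gauss_monomial (s : Fin N ⊕ Fin N →₀ ℕ) (c : ℂ) :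
    gauss N (MvPolynomial.monomial s c) = c * gaussMonomial s := by
  have h : gauss N (MvPolynomial.monomial s 1) = gaussMonomial s := by
    have h2 := congrFun (MvPolynomial.coe_basisMonomials (Fin N ⊕ Fin N) ℂ) s
    rw [gauss, ← h2, Module.Basis.constr_basis]
  rw [← mul_one c, ← smul_eq_mul, ← MvPolynomial.smul_monomial, map_smul, h, smul_eq_mul,
    smul_eq_mul, mul_one]

@[simp] theorem gauss_one : gauss N 1 = 1 := by
  have := gauss_monomial (N := N) 0 1
  simpa [gaussMonomial] using this

theorem gaussMonomial_add_single_inl (s : Fin N ⊕ Fin N →₀ ℕ) (i : Fin N) :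
    gaussMonomial (Finsupp.single (Sum.inl i) 1 + s) =
      s (Sum.inr i) * gaussMonomial (s - Finsupp.single (Sum.inr i) 1) := by
  classical
  rcases Nat.eq_zero_or_pos (s (Sum.inr i)) with h | h
  · rw [h, Nat.cast_zero, zero_mul, gaussMonomial, if_neg]
    intro h'
    have := h' i
    simp [h] at this
  have hiff : (∀ j, (Finsupp.single (Sum.inl i) 1 + s : Fin N ⊕ Fin N →₀ ℕ) (Sum.inl j) =
        (Finsupp.single (Sum.inl i) 1 + s : Fin N ⊕ Fin N →₀ ℕ) (Sum.inr j)) ↔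
      ∀ j, (s - Finsupp.single (Sum.inr i) 1 : Fin N ⊕ Fin N →₀ ℕ) (Sum.inl j) =
        (s - Finsupp.single (Sum.inr i) 1 : Fin N ⊕ Fin N →₀ ℕ) (Sum.inr j) := by
    refine forall_congr' fun j => ?_
    rcases eq_or_ne i j with rfl | hij
    · simp; omega
    · simp [hij]
  rw [gaussMonomial, gaussMonomial]
  by_cases hc : ∀ j, (s - Finsupp.single (Sum.inr i) 1 : Fin N ⊕ Fin N →₀ ℕ) (Sum.inl j) =
        (s - Finsupp.single (Sum.inr i) 1 : Fin N ⊕ Fin N →₀ ℕ) (Sum.inr j)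
  · rw [if_pos hc, if_pos (hiff.2 hc), ← Finset.mul_prod_erase _ _ (Finset.mem_univ i),
      ← Finset.mul_prod_erase Finset.univ (fun j => (((s - Finsupp.single (Sum.inr i) 1 : _ →₀ ℕ)
        (Sum.inl j)).factorial : ℂ)) (Finset.mem_univ i), ← mul_assoc]
    congr 1
    · have h1 := hc i
      simp only [Finsupp.coe_tsub, Pi.sub_apply, Finsupp.single_eq_same, ne_eq, reduceCtorEq,
        not_false_eq_true, Finsupp.single_eq_of_ne, tsub_zero] at h1
      obtain ⟨k, hk⟩ : ∃ k, s (Sum.inr i) = k + 1 := ⟨s (Sum.inr i) - 1, by omega⟩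
      have h2 : s (Sum.inl i) = k := by omega
      simp [h2, hk, Nat.factorial_succ, add_comm 1 k]
    · refine Finset.prod_congr rfl fun j hj => ?_
      have : i ≠ j := (Finset.ne_of_mem_erase hj).symm
      simp [this]
  · rw [if_neg hc, if_neg fun h' => hc (hiff.1 h'), mul_zero]

/-- Reduced to `gaussMonomial_add_single_inl` by the symmetry that exchanges `z` and `w`. -/
theorem gaussMonomial_add_single_inr (s : Fin N ⊕ Fin N →₀ ℕ) (i : Fin N) :
    gaussMonomial (Finsupp.single (Sum.inr i) 1 + s) =
      s (Sum.inl i) * gaussMonomial (s - Finsupp.single (Sum.inl i) 1) := by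
  have hswap : ∀ t : Fin N ⊕ Fin N →₀ ℕ,
      gaussMonomial (t.equivMapDomain (Equiv.sumComm _ _)) = gaussMonomial t := by
    intro t
    classical
    rw [gaussMonomial, gaussMonomial]
    by_cases hc : ∀ j, t (Sum.inl j) = t (Sum.inr j)
    · rw [if_pos hc, if_pos]
      · exact Finset.prod_congr rfl fun j _ => by simp [Finsupp.equivMapDomain_apply, hc j]
      · intro j
        simp [Finsupp.equivMapDomain_apply, hc j]
    · rw [if_neg hc, if_neg]
      intro h
      apply hc
      intro j
      simpa [Finsupp.equivMapDomain_apply] using (h j).symm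
  have h := gaussMonomial_add_single_inl (s.equivMapDomain (Equiv.sumComm _ _)) i
  rw [← hswap, ← hswap (s - _)]
  convert h using 2
  · ext (j | j) <;> simp [Finsupp.equivMapDomain_apply, Finsupp.single_apply]
  · simp [Finsupp.equivMapDomain_apply]
  · congr 1
    ext (j | j) <;> simp [Finsupp.equivMapDomain_apply, Finsupp.single_apply]

/-- Integration by parts: multiplication by `zᵢ` is adjoint to `∂/∂wᵢ`. -/
theorem gauss_zVar_mul (i : Fin N) (f : PairPoly N) :
    gauss N (zVar i * f) = gauss N (dw i f) := by
  induction f using MvPolynomial.induction_on' with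
  | monomial s c =>
    rw [zVar, MvPolynomial.X, MvPolynomial.monomial_mul, gauss_monomial,
      gaussMonomial_add_single_inl, dw, MvPolynomial.pderiv_monomial, gauss_monomial]
    ring
  | add p q hp hq => rw [mul_add, map_add, hp, hq, map_add, map_add]

/-- Integration by parts: multiplication by `wᵢ` is adjoint to `∂/∂zᵢ`. -/
theorem gauss_wVar_mul (i : Fin N) (f : PairPoly N) :
    gauss N (wVar i * f) = gauss N (dz i f) := by
  induction f using MvPolynomial.induction_on' with
  | monomial s c =>
    rw [wVar, MvPolynomial.X, MvPolynomial.monomial_mul, gauss_monomial,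
      gaussMonomial_add_single_inr, dz, MvPolynomial.pderiv_monomial, gauss_monomial]
    ring
  | add p q hp hq => rw [mul_add, map_add, hp, hq, map_add, map_add]

end Gauss

/-! ### Extension of scalars to an algebra of coefficients -/

section Extension

variable {N : ℕ} {A : Type*} [Ring A] [Algebra ℂ A]

/-- The Gaussian functional on polynomials with coefficients in a (noncommutative) algebra `A`. -/
def gaussExt (N : ℕ) (A : Type*) [Ring A] [Algebra ℂ A] : PairPoly N ⊗[ℂ] A →ₗ[ℂ] A :=
  (TensorProduct.lid ℂ A).toLinearMap ∘ₗ LinearMap.rTensor A (gauss N)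

@[simp] theorem gaussExt_tmul (p : PairPoly N) (a : A) : gaussExt N A (p ⊗ₜ a) = gauss N p • a := by
  simp [gaussExt]

/-- The extension of a derivation of the polynomials to polynomials with coefficients in `A`. -/
def derExt (A : Type*) [Ring A] [Algebra ℂ A] (d : Derivation ℂ (PairPoly N) (PairPoly N)) :
    PairPoly N ⊗[ℂ] A →ₗ[ℂ] PairPoly N ⊗[ℂ] A :=
  LinearMap.rTensor A (d : PairPoly N →ₗ[ℂ] PairPoly N)

variable (d : Derivation ℂ (PairPoly N) (PairPoly N))

@[simp] theorem derExt_tmul (p : PairPoly N) (a : A) : derExt A d (p ⊗ₜ a) = d p ⊗ₜ a := by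
  simp [derExt]

theorem derExt_mul (s t : PairPoly N ⊗[ℂ] A) :
    derExt A d (s * t) = derExt A d s * t + s * derExt A d t := by
  induction s with
  | zero => simp
  | add x y hx hy => rw [add_mul, map_add, hx, hy, map_add, add_mul, add_mul]; abel
  | tmul p a =>
    induction t with
    | zero => simp
    | add x y hx hy => rw [mul_add, map_add, hx, hy, map_add, mul_add, mul_add]; abel
    | tmul q b =>
      rw [Algebra.TensorProduct.tmul_mul_tmul, derExt_tmul, derExt_tmul, derExt_tmul,
        Algebra.TensorProduct.tmul_mul_tmul, Algebra.TensorProduct.tmul_mul_tmul,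
        ← TensorProduct.add_tmul, d.leibniz, smul_eq_mul, smul_eq_mul]
      congr 1
      ring

theorem tmul_one_mul (q : PairPoly N) (s : PairPoly N ⊗[ℂ] A) :
    q ⊗ₜ[ℂ] (1 : A) * s = q • s := by
  induction s with
  | zero => simp
  | add x y hx hy => rw [mul_add, hx, hy, smul_add]
  | tmul p a => rw [Algebra.TensorProduct.tmul_mul_tmul, one_mul, TensorProduct.smul_tmul',
      smul_eq_mul]

theorem derExt_smul (p : PairPoly N) (t : PairPoly N ⊗[ℂ] A) :
    derExt A d (p • t) = d p • t + p • derExt A d t := by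
  have h := derExt_mul d (p ⊗ₜ[ℂ] (1 : A)) t
  rwa [derExt_tmul, tmul_one_mul, tmul_one_mul, tmul_one_mul] at h

theorem gaussExt_zVar_smul (i : Fin N) (t : PairPoly N ⊗[ℂ] A) :
    gaussExt N A (zVar i • t) = gaussExt N A (derExt A (dw i) t) := by
  induction t with
  | zero => simp
  | add x y hx hy => simp only [smul_add, map_add, hx, hy]
  | tmul p a => rw [TensorProduct.smul_tmul', smul_eq_mul, gaussExt_tmul, gauss_zVar_mul,
      derExt_tmul, gaussExt_tmul]

theorem gaussExt_mul_one_tmul (t : PairPoly N ⊗[ℂ] A) (a : A) :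
    gaussExt N A (t * (1 ⊗ₜ a)) = gaussExt N A t * a := by
  induction t with
  | zero => simp
  | add x y hx hy => simp only [add_mul, map_add, hx, hy]
  | tmul p b => simp

theorem gaussExt_one_tmul_mul (t : PairPoly N ⊗[ℂ] A) (a : A) :
    gaussExt N A ((1 ⊗ₜ a) * t) = a * gaussExt N A t := by
  induction t with
  | zero => simp
  | add x y hx hy => simp only [mul_add, map_add, hx, hy]
  | tmul p b => simp

@[simp] theorem gaussExt_one : gaussExt N A 1 = 1 := by
  rw [Algebra.TensorProduct.one_def, gaussExt_tmul, gauss_one, one_smul]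

end Extension

/-! ### Gaussian moments of a bilinear form -/

theorem derivation_prod {R : Type*} [CommRing R] {k : Type*} [CommRing k] [Algebra k R]
    {n : Type*} [DecidableEq n] (d : Derivation k R R) (s : Finset n) (f : n → R) :
    d (∏ i ∈ s, f i) = ∑ i ∈ s, (∏ j ∈ s.erase i, f j) * d (f i) := by
  induction s using Finset.induction_on with
  | empty => simp
  | insert a s ha ih =>
    rw [Finset.prod_insert ha, d.leibniz, ih, Finset.sum_insert ha, Finset.erase_insert ha,
      smul_eq_mul, smul_eq_mul, Finset.mul_sum, add_comm]
    congr 1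
    refine Finset.sum_congr rfl fun i hi => ?_
    have hia : a ≠ i := fun h => ha (h ▸ hi)
    rw [Finset.erase_insert_of_ne hia, Finset.prod_insert fun h => ha (Finset.mem_of_mem_erase h),
      mul_assoc]

/-- **Jacobi's formula** for a derivation `d` of a commutative ring:
`d (det M) = tr (adj M · dM)`. -/
theorem derivation_det {R : Type*} [CommRing R] {k : Type*} [CommRing k] [Algebra k R]
    {n : Type*} [Fintype n] [DecidableEq n] (d : Derivation k R R) (M : Matrix n n R) :
    d M.det = (M.adjugate * M.map d).trace := by
  have h1 : d M.det = ∑ i, (M.updateCol i fun k => d (M k i)).det := by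
    simp_rw [Matrix.det_apply]
    rw [map_sum, Finset.sum_comm]
    refine Finset.sum_congr rfl fun σ _ => ?_
    rw [← Finset.smul_sum, Units.smul_def, Units.smul_def, map_zsmul, derivation_prod]
    congr 1
    refine Finset.sum_congr rfl fun i _ => ?_
    rw [← Finset.prod_erase_mul _ _ (Finset.mem_univ i), Matrix.updateCol_self]
    congr 1
    exact Finset.prod_congr rfl fun j hj => by
      rw [Matrix.updateCol_ne (Finset.ne_of_mem_erase hj)]
  rw [h1, Matrix.trace]
  refine Finset.sum_congr rfl fun i _ => ?_
  rw [← Matrix.cramer_apply, Matrix.cramer_eq_adjugate_mulVec]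
  rfl

/-- The form `∑ᵢⱼ wᵢ aᵢⱼ zⱼ` attached to a matrix `a` with entries in an algebra. -/
def pairForm {N : ℕ} {A : Type*} [Ring A] [Algebra ℂ A] (a : Matrix (Fin N) (Fin N) A) :
    PairPoly N ⊗[ℂ] A :=
  ∑ i, ∑ j, (wVar i * zVar j) ⊗ₜ a i j

section Forms

variable {N : ℕ} {A : Type*} [Ring A] [Algebra ℂ A] (a : Matrix (Fin N) (Fin N) A)

theorem derExt_dw_pairForm (i : Fin N) : derExt A (dw i) (pairForm a) =
    ∑ j, zVar j ⊗ₜ a i j := by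
  simp only [pairForm, map_sum, derExt_tmul, Derivation.leibniz, dw_zVar, dw_wVar]
  rw [Finset.sum_eq_single i]
  · simp
  · intro j _ hj
    simp [hj.symm]
  · simp

theorem gaussExt_pairForm_mul (t : PairPoly N ⊗[ℂ] A) :
    gaussExt N A (pairForm a * t) =
      ∑ i, ∑ j, a i j * gaussExt N A ((wVar i * zVar j) • t) := by
  simp only [pairForm, Finset.sum_mul, map_sum]
  refine Finset.sum_congr rfl fun i _ => Finset.sum_congr rfl fun j _ => ?_
  rw [← gaussExt_one_tmul_mul, ← tmul_one_mul, ← mul_assoc, Algebra.TensorProduct.tmul_mul_tmul,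
    one_mul, mul_one]

end Forms

section Moments

variable {N : ℕ} {R : Type*} [CommRing R] [Algebra ℂ R] (A : Matrix (Fin N) (Fin N) R)

theorem derExt_pow (d : Derivation ℂ (PairPoly N) (PairPoly N)) (t : PairPoly N ⊗[ℂ] R) (n : ℕ) :
    derExt R d (t ^ (n + 1)) = ((n : ℂ) + 1) • (t ^ n * derExt R d t) := by
  induction n with
  | zero => simp
  | succ n ih =>
    rw [pow_succ, derExt_mul, ih]
    push_cast
    rw [smul_mul_assoc, mul_right_comm, ← pow_succ, add_smul ((n : ℂ) + 1) 1, one_smul]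

/-- The exponential generating function of the moments of `∑ᵢⱼ wᵢ Aᵢⱼ zⱼ`. -/
def momentSeries : PowerSeries R :=
  PowerSeries.mk fun n => ((n.factorial : ℂ)⁻¹) • gaussExt N R (pairForm A ^ n)

/-- The exponential generating function of the moments of `∑ᵢⱼ wᵢ Aᵢⱼ zⱼ` weighted by
`zᵢ wⱼ`, as a matrix in `i`, `j`. -/
def momentMatrix : Matrix (Fin N) (Fin N) (PowerSeries R) :=
  Matrix.of fun i j => PowerSeries.mk fun n =>
    ((n.factorial : ℂ)⁻¹) • gaussExt N R ((zVar i * wVar j) • pairForm A ^ n)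

theorem constantCoeff_momentSeries : PowerSeries.constantCoeff (momentSeries A) = 1 := by
  rw [← PowerSeries.coeff_zero_eq_constantCoeff_apply, momentSeries, PowerSeries.coeff_mk]
  simp

/-- Integration by parts in the variable `zᵢ`. -/
theorem gaussExt_zVar_mul_wVar_smul_pow (i j : Fin N) (n : ℕ) :
    gaussExt N R ((zVar i * wVar j) • pairForm A ^ (n + 1)) =
      (if i = j then gaussExt N R (pairForm A ^ (n + 1)) else 0) +
        ((n : ℂ) + 1) • ∑ k, A i k * gaussExt N R ((zVar k * wVar j) • pairForm A ^ n) := by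
  rw [mul_smul, gaussExt_zVar_smul, derExt_smul, map_add, dw_wVar, derExt_pow,
    derExt_dw_pairForm]
  congr 1
  · split_ifs <;> simp
  · rw [smul_comm, map_smul, Finset.mul_sum, Finset.smul_sum, map_sum]
    congr 1
    refine Finset.sum_congr rfl fun k _ => ?_
    rw [mul_comm (A i k), ← gaussExt_mul_one_tmul, mul_comm (zVar k), mul_smul,
      smul_mul_assoc, ← tmul_one_mul (zVar k), mul_comm (zVar k ⊗ₜ[ℂ] (1 : R)), mul_assoc,
      Algebra.TensorProduct.tmul_mul_tmul, one_mul, mul_one]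

/-- The matrix of weighted moments is the resolvent `(1 - sA)⁻¹` times the series of moments. -/
theorem momentMatrix_eq :
    (1 - (PowerSeries.X : PowerSeries R) • A.map (PowerSeries.C : R →+* PowerSeries R)) *
      momentMatrix A = momentSeries A • 1 := by
  rw [sub_mul, one_mul, sub_eq_iff_eq_add]
  ext i j n
  rw [Matrix.add_apply, Matrix.smul_mul, Matrix.smul_apply, Matrix.smul_apply, Matrix.mul_apply,
    map_add, smul_eq_mul, smul_eq_mul, Matrix.one_apply, momentMatrix, momentSeries]
  simp only [Matrix.of_apply, PowerSeries.coeff_mk, Matrix.map_apply]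
  cases n with
  | zero =>
    rw [PowerSeries.coeff_zero_X_mul, mul_ite, mul_one, mul_zero, apply_ite (PowerSeries.coeff 0)]
    simp only [PowerSeries.coeff_mk, map_zero, pow_zero]
    rw [mul_smul, gaussExt_zVar_smul, derExt_smul, dw_wVar,
      show derExt R (dw i) (1 : PairPoly N ⊗[ℂ] R) = 0 by
        rw [Algebra.TensorProduct.one_def, derExt_tmul]; simp]
    split_ifs <;> simp
  | succ n =>
    rw [PowerSeries.coeff_succ_X_mul, gaussExt_zVar_mul_wVar_smul_pow, map_sum, mul_ite, mul_one,
      mul_zero, apply_ite (PowerSeries.coeff (n + 1)), PowerSeries.coeff_mk, map_zero, smul_add]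
    congr 1
    · split_ifs <;> simp
    · simp only [PowerSeries.coeff_C_mul, PowerSeries.coeff_mk]
      rw [smul_smul, Finset.smul_sum]
      refine Finset.sum_congr rfl fun k _ => ?_
      rw [mul_smul_comm]
      congr 1
      rw [Nat.factorial_succ]
      push_cast
      field_simp

/-- The logarithmic derivative of the series of moments is `tr(A (1 - sA)⁻¹)`. -/
theorem derivative_momentSeries :
    PowerSeries.derivative R (momentSeries A) =
      (A.map (PowerSeries.C : R →+* PowerSeries R) * momentMatrix A).trace := by
  ext n
  rw [PowerSeries.coeff_derivative, momentSeries,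
    PowerSeries.coeff_mk, pow_succ', gaussExt_pairForm_mul, Matrix.trace, map_sum,
    Finset.smul_sum, Finset.sum_mul]
  refine Finset.sum_congr rfl fun i _ => ?_
  rw [Matrix.diag_apply, Matrix.mul_apply, map_sum, Finset.smul_sum, Finset.sum_mul]
  refine Finset.sum_congr rfl fun j _ => ?_
  rw [Matrix.map_apply, PowerSeries.coeff_C_mul, momentMatrix, Matrix.of_apply,
    PowerSeries.coeff_mk, mul_comm (wVar i)]
  have h : ((n : R) + 1) = algebraMap ℂ R ((n : ℂ) + 1) := by simp
  rw [h, mul_comm _ (algebraMap ℂ R _), ← Algebra.smul_def, smul_smul, mul_smul_comm]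
  congr 1
  rw [Nat.factorial_succ]
  push_cast
  field_simp

/-- The generating function of the moments of a bilinear form is the inverse of a determinant:
both satisfy the same first order differential equation. -/
theorem momentSeries_mul_det [IsAddTorsionFree R] : momentSeries A *
    (1 - (PowerSeries.X : PowerSeries R) • A.map (PowerSeries.C : R →+* PowerSeries R)).det =
      1 := by
  set B := A.map (PowerSeries.C : R →+* PowerSeries R) with hB
  set M := 1 - (PowerSeries.X : PowerSeries R) • B with hM
  have hadj : M.det • momentMatrix A = momentSeries A • M.adjugate := by
    have h := congrArg (fun Y => M.adjugate * Y) (momentMatrix_eq A)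
    simp only [← hB, ← hM] at h
    rw [← Matrix.mul_assoc, Matrix.adjugate_mul, Matrix.smul_mul, Matrix.one_mul,
      Matrix.mul_smul, Matrix.mul_one] at h
    exact h
  have hd : M.map (PowerSeries.derivative R) = -B := by
    ext i j : 2
    rw [Matrix.map_apply, hM, Matrix.sub_apply, Matrix.smul_apply, map_sub, smul_eq_mul,
      Derivation.leibniz, hB, Matrix.map_apply, PowerSeries.derivative_C, PowerSeries.derivative_X,
      Matrix.one_apply, Matrix.neg_apply, Matrix.map_apply]
    split_ifs <;> simp
  refine PowerSeries.derivative.ext ?_ ?_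
  · have h := congrArg (fun Y => (B * Y).trace) hadj
    simp only [Matrix.mul_smul, Matrix.trace_smul, smul_eq_mul] at h
    rw [Derivation.leibniz, derivation_det, derivative_momentSeries, hd, Derivation.map_one_eq_zero,
      smul_eq_mul, smul_eq_mul, ← hB, h, Matrix.mul_neg, Matrix.trace_neg, Matrix.trace_mul_comm B]
    ring
  · rw [map_mul, constantCoeff_momentSeries, one_mul, RingHom.map_det]
    have : (PowerSeries.constantCoeff (R := R)).mapMatrix M = 1 := by
      rw [hM, map_sub, map_one]
      ext i j
      simp [RingHom.mapMatrix_apply]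
    rw [this, Matrix.det_one, map_one]

end Moments

/-! ### The series `det(1 + τ²A²)^(-1/2)` and the resolvent as Gaussian moments -/

section SkewMoments

variable {N : ℕ} {R : Type*} [CommRing R] [Algebra ℂ R]

theorem isAddTorsionFree_of_complexAlgebra (R : Type*) [CommRing R] [Algebra ℂ R] :
    IsAddTorsionFree R := by
  refine ⟨fun n hn x y h => ?_⟩
  have h' : (n : ℂ) • x = (n : ℂ) • y := by
    simpa only [Nat.cast_smul_eq_nsmul] using h
  have hn' : (n : ℂ) ≠ 0 := Nat.cast_ne_zero.2 hn
  simpa [smul_smul, inv_mul_cancel₀ hn'] using congrArg (fun t => (n : ℂ)⁻¹ • t) h'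

theorem constantCoeff_onePlusPow (α : ℂ) {T : PowerSeries R}
    (hT : PowerSeries.constantCoeff T = 0) :
    PowerSeries.constantCoeff (onePlusPow α T) = 1 := by
  have hs : PowerSeries.HasSubst T := PowerSeries.HasSubst.of_constantCoeff_zero' hT
  rw [← PowerSeries.coeff_zero_eq_constantCoeff_apply, onePlusPow, PowerSeries.coeff_subst' hs,
    finsum_eq_single _ 0]
  · simp
  · intro n hn
    simp [hT, hn]

theorem constantCoeff_detInvSqrt (A : Matrix (Fin N) (Fin N) R) :
    PowerSeries.constantCoeff (detInvSqrt A) = 1 :=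
  constantCoeff_onePlusPow _ (by rw [map_sub, constantCoeff_det_onePlusSq]; simp)

theorem detInvSqrt_sq_mul (A : Matrix (Fin N) (Fin N) R) :
    detInvSqrt A ^ 2 * (onePlusSq A).det = 1 := by
  have h := onePlusPow_neg_half_sq (R := R) (T := (onePlusSq A).det - 1)
    (by rw [map_sub, constantCoeff_det_onePlusSq]; simp)
  rwa [add_sub_cancel] at h

/-- A power series has at most one inverse square root with constant coefficient `1`. -/
theorem inv_sqrt_unique {f g u : PowerSeries R} (hf : f ^ 2 * u = 1) (hg : g ^ 2 * u = 1)
    (hf1 : PowerSeries.constantCoeff f = 1) (hg1 : PowerSeries.constantCoeff g = 1) : f = g := by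
  have hu : IsUnit u := IsUnit.of_mul_eq_one _ ((mul_comm _ _).trans hf)
  have h2 : IsUnit (f + g) := by
    rw [PowerSeries.isUnit_iff_constantCoeff, map_add, hf1, hg1, one_add_one_eq_two,
      show (2 : R) = algebraMap ℂ R 2 from (map_ofNat (algebraMap ℂ R) 2).symm]
    exact (isUnit_iff_ne_zero.2 two_ne_zero).map _
  have h : (f - g) * ((f + g) * u) = 0 := by linear_combination hf - hg
  exact sub_eq_zero.1 ((h2.mul hu).mul_left_eq_zero.1 h)

/-- The substitution `s ↦ i τ` in power series. -/
def rotate (R : Type*) [CommRing R] [Algebra ℂ R] : PowerSeries R →+* PowerSeries R :=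
  PowerSeries.rescale (algebraMap ℂ R Complex.I)

theorem coeff_rotate (f : PowerSeries R) (n : ℕ) :
    PowerSeries.coeff n (rotate R f) = Complex.I ^ n • PowerSeries.coeff n f := by
  rw [rotate, PowerSeries.coeff_rescale, ← map_pow, Algebra.smul_def]

/-- The matrix `i τ A`. -/
def rotX (A : Matrix (Fin N) (Fin N) R) : Matrix (Fin N) (Fin N) (PowerSeries R) :=
  (Complex.I • (PowerSeries.X : PowerSeries R)) • A.map (PowerSeries.C : R →+* PowerSeries R)

theorem rotate_mapMatrix (A : Matrix (Fin N) (Fin N) R) :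
    (rotate R).mapMatrix
      (1 - (PowerSeries.X : PowerSeries R) • A.map (PowerSeries.C : R →+* PowerSeries R)) =
      1 - rotX A := by
  rw [map_sub, map_one]
  congr 1
  ext i j n
  rw [RingHom.mapMatrix_apply, Matrix.map_apply, coeff_rotate, rotX]
  simp only [Matrix.smul_apply, Matrix.map_apply, smul_eq_mul, smul_mul_assoc]
  rw [PowerSeries.coeff_smul]
  cases n with
  | zero => simp
  | succ n =>
    rw [PowerSeries.coeff_succ_X_mul, PowerSeries.coeff_C]
    split_ifs with h <;> simp [h]

theorem rotX_sq (A : Matrix (Fin N) (Fin N) R) : onePlusSq A = 1 - rotX A * rotX A := by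
  rw [onePlusSq, rotX, Matrix.smul_mul, Matrix.mul_smul, smul_smul, ← pow_two, sub_eq_add_neg,
    smul_pow, Complex.I_sq, neg_smul (1 : ℂ), one_smul, neg_smul, neg_neg, pow_two (A.map _)]

variable {A : Matrix (Fin N) (Fin N) R} (hA : Aᵀ = -A)

include hA

theorem transpose_one_sub_rotX : (1 - rotX A)ᵀ = 1 + rotX A := by
  have : (A.map (PowerSeries.C : R →+* PowerSeries R))ᵀ =
      -A.map (PowerSeries.C : R →+* PowerSeries R) := by
    rw [← Matrix.transpose_map, hA]
    ext i j : 2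
    simp
  rw [Matrix.transpose_sub, Matrix.transpose_one, rotX, Matrix.transpose_smul, this, smul_neg,
    sub_neg_eq_add]

/-- For skew-symmetric `A`, the determinant of `1 + τ²A²` is the square of that of `1 - iτA`. -/
theorem rotate_momentSeries : rotate R (momentSeries A) = detInvSqrt A := by
  have := isAddTorsionFree_of_complexAlgebra R
  have h := congrArg (rotate R) (momentSeries_mul_det A)
  rw [map_mul, map_one, RingHom.map_det, rotate_mapMatrix] at h
  have h' := h
  rw [← Matrix.det_transpose, transpose_one_sub_rotX hA] at h'
  refine inv_sqrt_unique (u := (onePlusSq A).det) ?_ (detInvSqrt_sq_mul A) ?_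
    (constantCoeff_detInvSqrt A)
  · have hm : onePlusSq A = (1 - rotX A) * (1 + rotX A) := by
      rw [rotX_sq]; noncomm_ring
    rw [hm, Matrix.det_mul]
    calc _ = (rotate R (momentSeries A) * (1 - rotX A).det) *
          (rotate R (momentSeries A) * (1 + rotX A).det) := by ring
      _ = 1 := by rw [h, h', one_mul]
  · rw [← PowerSeries.coeff_zero_eq_constantCoeff_apply, coeff_rotate, pow_zero, one_smul,
      PowerSeries.coeff_zero_eq_constantCoeff_apply, constantCoeff_momentSeries]

/-- The antisymmetric part of the matrix of weighted moments is
`(1 - iτA)⁻¹ - (1 + iτA)⁻¹ = 2iτA (1 + τ²A²)⁻¹`, up to the factor `det(1 + τ²A²)^(-1/2)`. -/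
theorem rotate_momentMatrix_sub_transpose :
    (rotate R).mapMatrix (momentMatrix A) - ((rotate R).mapMatrix (momentMatrix A))ᵀ =
      detInvSqrt A • ((2 : PowerSeries R) • rotX A * (onePlusSq A)⁻¹) := by
  set M := (rotate R).mapMatrix (momentMatrix A) with hM
  set T := rotX A with hT
  set φ := detInvSqrt A with hφ
  -- `M = φ (1 - T)⁻¹` and `Mᵀ = φ (1 + T)⁻¹`, as `T` is skew-symmetric.
  have h1 : (1 - T) * M = φ • 1 := by
    have h := congrArg (rotate R).mapMatrix (momentMatrix_eq A)
    rw [map_mul, rotate_mapMatrix] at h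
    rw [h]
    ext i j : 2
    rw [RingHom.mapMatrix_apply, Matrix.map_apply, Matrix.smul_apply, Matrix.smul_apply,
      smul_eq_mul, smul_eq_mul, map_mul, rotate_momentSeries hA, ← hφ, Matrix.one_apply]
    split_ifs <;> simp
  have hφu : IsUnit φ := by
    rw [PowerSeries.isUnit_iff_constantCoeff, hφ, constantCoeff_detInvSqrt]
    exact isUnit_one
  obtain ⟨ψ, hψ⟩ := hφu.exists_left_inv
  have h2 : M * (1 - T) = φ • 1 := by
    have e1 : (1 - T) * (ψ • M) = 1 := by
      rw [Matrix.mul_smul, h1, smul_smul, hψ, one_smul]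
    have e2 := mul_eq_one_comm.1 e1
    rw [Matrix.smul_mul] at e2
    have e3 := congrArg (fun Y => φ • Y) e2
    simpa [smul_smul, mul_comm φ ψ, hψ] using e3
  have h3 : Mᵀ * (1 + T) = φ • 1 := by
    have e := congrArg Matrix.transpose h1
    rwa [Matrix.transpose_mul, hT, transpose_one_sub_rotX hA, Matrix.transpose_smul,
      Matrix.transpose_one, ← hT] at e
  have hdet : IsUnit (onePlusSq A).det := by
    rw [PowerSeries.isUnit_iff_constantCoeff, constantCoeff_det_onePlusSq]
    exact isUnit_one
  have key : (M - Mᵀ) * onePlusSq A = φ • ((2 : PowerSeries R) • T) := by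
    have e : (M - Mᵀ) * onePlusSq A =
        M * (1 - T) * (1 + T) - Mᵀ * (1 + T) * (1 - T) := by
      rw [rotX_sq]; noncomm_ring
    rw [e, h2, h3, Matrix.smul_mul, Matrix.smul_mul, ← smul_sub, Matrix.one_mul, Matrix.one_mul,
      two_smul]
    congr 1
    abel
  have := congrArg (fun Y => Y * (onePlusSq A)⁻¹) key
  simp only [Matrix.mul_assoc, Matrix.mul_nonsing_inv _ hdet, Matrix.mul_one] at this
  rw [this, Matrix.smul_mul]

/-- The coefficients of `det(1 + τ²A²)^(-1/2)` are Gaussian moments of the form defined by `A`. -/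
theorem coeff_detInvSqrt (j : ℕ) : PowerSeries.coeff (2 * j) (detInvSqrt A) =
    ((-1 : ℂ) ^ j * ((2 * j).factorial : ℂ)⁻¹) • gaussExt N R (pairForm A ^ (2 * j)) := by
  rw [← rotate_momentSeries hA, coeff_rotate, momentSeries, PowerSeries.coeff_mk, smul_smul,
    pow_mul, Complex.I_sq]

end SkewMoments

/-- The polynomial `(w, y) (z, x) - (w, x) (z, y)`. -/
def wedgeForm {N : ℕ} (x y : Fin N → ℂ) : PairPoly N :=
  (∑ i, y i • wVar i) * (∑ i, x i • zVar i) - (∑ i, x i • wVar i) * (∑ i, y i • zVar i)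

theorem coeff_resolventSeries {N : ℕ} {R : Type*} [CommRing R] [Algebra ℂ R]
    {A : Matrix (Fin N) (Fin N) R} (hA : Aᵀ = -A) (x y : Fin N → ℂ) (j : ℕ) :
    PowerSeries.coeff (2 * j) (resolventSeries A x y) =
      ((1 / 2 : ℂ) * (-1) ^ j * ((2 * j + 1).factorial : ℂ)⁻¹) •
        gaussExt N R (wedgeForm x y • pairForm A ^ (2 * j + 1)) := by
  set x' : Fin N → PowerSeries R := fun i => algebraMap ℂ (PowerSeries R) (x i) with hx'
  set y' : Fin N → PowerSeries R := fun i => algebraMap ℂ (PowerSeries R) (y i) with hy'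
  have h1 : x' ⬝ᵥ ((rotate R).mapMatrix (momentMatrix A) -
      ((rotate R).mapMatrix (momentMatrix A))ᵀ) *ᵥ y' =
      (2 * Complex.I) • (PowerSeries.X * resolventSeries A x y) := by
    rw [rotate_momentMatrix_sub_transpose hA, rotX, resolventSeries, ← hx', ← hy', smul_smul,
      Matrix.smul_mul, smul_smul, Matrix.smul_mulVec, dotProduct_smul, smul_eq_mul, mul_smul_comm,
      mul_smul_comm, smul_mul_assoc, mul_smul, two_smul ℂ, two_mul]
    simp only [mul_add, add_mul, smul_add]
    ring_nf
  have h2 := congrArg (PowerSeries.coeff (2 * j + 1)) h1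
  rw [PowerSeries.coeff_smul, PowerSeries.coeff_succ_X_mul] at h2
  have h3 : PowerSeries.coeff (2 * j + 1) (x' ⬝ᵥ ((rotate R).mapMatrix (momentMatrix A) -
      ((rotate R).mapMatrix (momentMatrix A))ᵀ) *ᵥ y') =
      (Complex.I ^ (2 * j + 1) * ((2 * j + 1).factorial : ℂ)⁻¹) •
        gaussExt N R (wedgeForm x y • pairForm A ^ (2 * j + 1)) := by
    have e : wedgeForm x y = ∑ i, ∑ k, (x i * y k) •
        ((zVar i * wVar k) - (zVar k * wVar i) : PairPoly N) := by
      simp only [wedgeForm, Finset.sum_mul_sum, smul_sub, Finset.sum_sub_distrib]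
      congr 1
      · rw [Finset.sum_comm]
        refine Finset.sum_congr rfl fun i _ => Finset.sum_congr rfl fun k _ => ?_
        rw [smul_mul_smul_comm, mul_comm (y k), mul_comm (wVar k)]
      · refine Finset.sum_congr rfl fun i _ => Finset.sum_congr rfl fun k _ => ?_
        rw [smul_mul_smul_comm, mul_comm (wVar i)]
    rw [e, dotProduct, map_sum, Finset.sum_smul, map_sum, Finset.smul_sum]
    refine Finset.sum_congr rfl fun i _ => ?_
    rw [Matrix.mulVec, dotProduct, Finset.mul_sum, map_sum, Finset.sum_smul, map_sum,
      Finset.smul_sum]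
    refine Finset.sum_congr rfl fun k _ => ?_
    have t : x' i * (((rotate R).mapMatrix (momentMatrix A) -
        ((rotate R).mapMatrix (momentMatrix A))ᵀ) i k * y' k) =
        (x i * y k) • (rotate R (momentMatrix A i k) - rotate R (momentMatrix A k i)) := by
      rw [Algebra.smul_def, map_mul, hx', hy', Matrix.sub_apply, Matrix.transpose_apply,
        RingHom.mapMatrix_apply, Matrix.map_apply, Matrix.map_apply]
      ring
    rw [t, PowerSeries.coeff_smul, map_sub, coeff_rotate, coeff_rotate, momentMatrix,
      Matrix.of_apply, Matrix.of_apply, PowerSeries.coeff_mk, PowerSeries.coeff_mk, smul_assoc,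
      (gaussExt N R).map_smul, sub_smul, (gaussExt N R).map_sub, smul_smul, smul_smul, ← smul_sub,
      smul_smul, smul_smul]
    congr 1
    ring
  rw [h2] at h3
  have h4 := congrArg (fun t => (2 * Complex.I)⁻¹ • t) h3
  simp only [smul_smul] at h4
  rw [inv_mul_cancel₀ (by simp), one_smul] at h4
  rw [h4]
  congr 1
  rw [pow_succ, pow_mul, Complex.I_sq]
  field_simp

/-! ### Symmetrization of Gaussian moments -/

section Polarization

variable {N : ℕ}

theorem prod_ofFn_tmul {A : Type*} [Ring A] [Algebra ℂ A] {n : ℕ} (q : Fin n → PairPoly N)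
    (a : Fin n → A) : (List.ofFn fun i => q i ⊗ₜ[ℂ] a i).prod =
      (∏ i, q i) ⊗ₜ[ℂ] (List.ofFn a).prod := by
  induction n with
  | zero => simp [Algebra.TensorProduct.one_def]
  | succ n ih =>
    rw [List.ofFn_succ, List.prod_cons, ih, Fin.prod_univ_succ, List.ofFn_succ, List.prod_cons,
      Algebra.TensorProduct.tmul_mul_tmul]

/-- The moment of a power of a linear form, expanded into ordered words in the coefficients. -/
theorem gaussExt_smul_pow {A : Type*} [Ring A] [Algebra ℂ A] {K : Type*} [Fintype K]
    (p : PairPoly N) (q : K → PairPoly N) (a : K → A) (n : ℕ) :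
    gaussExt N A (p • (∑ e, q e ⊗ₜ[ℂ] a e) ^ n) =
      ∑ f : Fin n → K, gauss N (p * ∏ i, q (f i)) • (List.ofFn fun i => a (f i)).prod := by
  classical
  rw [← MultilinearMap.mkPiAlgebraFin_apply_const (R := ℂ), MultilinearMap.map_sum,
    Finset.smul_sum, map_sum]
  refine Finset.sum_congr rfl fun f _ => ?_
  rw [MultilinearMap.mkPiAlgebraFin_apply, prod_ofFn_tmul, TensorProduct.smul_tmul', smul_eq_mul,
    gaussExt_tmul]

/-- Symmetrization turns a Gaussian moment over `S(L)` into the same moment over `U(L)`: in the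
expansion of a power of a linear form with coefficients in `L`, every monomial occurs in all its
orderings, with the same weight. -/
theorem symmetrization_gaussExt_sum {L : Type*} [LieRing L] [LieAlgebra ℂ L] {K : Type*}
    [Fintype K] (p : PairPoly N) (q : K → PairPoly N) (c : K → L) (n : ℕ) :
    symmetrization (gaussExt N (SymmetricAlgebra ℂ L)
        (p • (∑ e, q e ⊗ₜ[ℂ] SymmetricAlgebra.ι ℂ L (c e)) ^ n)) =
      gaussExt N (UniversalEnvelopingAlgebra ℂ L)
        (p • (∑ e, q e ⊗ₜ[ℂ] UniversalEnvelopingAlgebra.ι ℂ (c e)) ^ n) := by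
  rw [gaussExt_smul_pow, gaussExt_smul_pow, map_sum]
  simp_rw [map_smul, List.prod_ofFn, symmetrization_prod, symProd, smul_comm _ ((n.factorial : ℂ)⁻¹),
    ← Finset.smul_sum]
  rw [inv_smul_eq_iff₀ (Nat.cast_ne_zero.2 n.factorial_ne_zero)]
  simp_rw [Finset.smul_sum]
  rw [Finset.sum_comm]
  have h : ∀ σ : Equiv.Perm (Fin n), ∑ f : Fin n → K, gauss N (p * ∏ i, q (f i)) •
      (List.ofFn fun i => UniversalEnvelopingAlgebra.ι ℂ (c (f (σ i)))).prod =
      ∑ f : Fin n → K, gauss N (p * ∏ i, q (f i)) •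
        (List.ofFn fun i => UniversalEnvelopingAlgebra.ι ℂ (c (f i))).prod := by
    intro σ
    refine Fintype.sum_equiv (Equiv.arrowCongr σ.symm (Equiv.refl K)) _ _ fun f => ?_
    have : ∏ i, q (f i) = ∏ i, q (f (σ i)) := (Equiv.prod_comp σ fun i => q (f i)).symm
    rw [this]
    rfl
  rw [Finset.sum_congr rfl fun σ _ => h σ, Finset.sum_const, Finset.card_univ, Fintype.card_perm,
    Fintype.card_fin, ← Nat.cast_smul_eq_nsmul ℂ, Finset.smul_sum]

theorem pairForm_eq_sum_prod {A : Type*} [Ring A] [Algebra ℂ A] (a : Matrix (Fin N) (Fin N) A) :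
    pairForm a = ∑ e : Fin N × Fin N, (wVar e.1 * zVar e.2) ⊗ₜ[ℂ] a e.1 e.2 := by
  rw [Fintype.sum_prod_type]
  rfl

/-- The matrix of generators `(E_{ji} - E_{ij}) / 2` of `U(𝔰𝔬_N)`. -/
def envMatrix (N : ℕ) : Matrix (Fin N) (Fin N) (UniversalEnvelopingAlgebra ℂ (soN N)) :=
  Matrix.of fun i j => UniversalEnvelopingAlgebra.ι ℂ (coord N i j)

theorem symmetrization_gaussExt (p : PairPoly N) (n : ℕ) :
    symmetrization (gaussExt N _ (p • pairForm (genericMatrix N) ^ n)) =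
      gaussExt N _ (p • pairForm (envMatrix N) ^ n) := by
  rw [pairForm_eq_sum_prod, pairForm_eq_sum_prod]
  exact symmetrization_gaussExt_sum p _ (fun e : Fin N × Fin N => coord N e.1 e.2) n

theorem coord_swap (i j : Fin N) : coord N j i = -coord N i j := by
  apply Subtype.ext
  simp only [coord, NegMemClass.coe_neg]
  rw [← smul_neg, neg_sub]

theorem genericMatrix_transpose : (genericMatrix N)ᵀ = -genericMatrix N := by
  ext i j
  rw [Matrix.transpose_apply, Matrix.neg_apply, genericMatrix, Matrix.of_apply, Matrix.of_apply,
    coord_swap, map_neg]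

/-- `r_{2j+1}(x, y)` as a Gaussian moment over `U(𝔰𝔬_N)`. -/
theorem rOdd_eq (j : ℕ) (x y : VN N) : rOdd N j x y =
    ((1 / 2 : ℂ) * (-1) ^ j * ((2 * j + 1).factorial : ℂ)⁻¹) •
      gaussExt N _ (wedgeForm x y • pairForm (envMatrix N) ^ (2 * j + 1)) := by
  rw [rOdd, gammaOdd, coeff_resolventSeries genericMatrix_transpose, map_smul,
    symmetrization_gaussExt]

/-- The residue picks out the coefficients of `z^(2j)`. -/
theorem casimirSymbol_eq (m : ℕ) (ζ : ℕ → ℂ) : casimirSymbol N m ζ =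
    ∑ j ∈ Finset.Icc 1 (m + 1),
      gCoeff N m ζ j • PowerSeries.coeff (2 * j) (detInvSqrt (genericMatrix N)) := by
  rw [casimirSymbol, residue, gPoly, Polynomial.eval₂_finsetSum, Finset.sum_mul,
    Finset.sum_mul, HahnSeries.coeff_sum]
  refine Finset.sum_congr rfl fun j _ => ?_
  rw [Polynomial.eval₂_monomial, HahnSeries.single_pow, one_pow, RingHom.comp_apply,
    HahnSeries.C_apply, HahnSeries.single_mul_single, zero_add, mul_one,
    HahnSeries.coeff_mul_single, HahnSeries.coeff_single_mul, mul_one,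
    show (-1 : ℤ) - -1 - j • -2 = ((2 * j : ℕ) : ℤ) by push_cast; rw [nsmul_eq_mul]; ring,
    HahnSeries.ofPowerSeries_apply_coeff, Algebra.smul_def]

/-- `C` as a combination of Gaussian moments over `U(𝔰𝔬_N)`. -/
theorem casimirC_eq (m : ℕ) (ζ : ℕ → ℂ) : casimirC N m ζ =
    ∑ j ∈ Finset.Icc 1 (m + 1), (gCoeff N m ζ j * ((-1) ^ j * ((2 * j).factorial : ℂ)⁻¹)) •
      gaussExt N _ (pairForm (envMatrix N) ^ (2 * j)) := by
  rw [casimirC, casimirSymbol_eq, map_sum]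
  refine Finset.sum_congr rfl fun j _ => ?_
  have h := symmetrization_gaussExt (N := N) 1 (2 * j)
  rw [one_smul, one_smul] at h
  rw [map_smul, coeff_detInvSqrt genericMatrix_transpose, map_smul, h, smul_smul]

end Polarization

/-! ### Functions of the bivector `z ∧ w` -/

section Bivector

variable {N : ℕ}

/-- The pairing `(z, α)` with a vector of polynomials. -/
def zDot (α : Fin N → PairPoly N) : PairPoly N := ∑ k, zVar k * α k

/-- The pairing `(w, α)` with a vector of polynomials. -/
def wDot (α : Fin N → PairPoly N) : PairPoly N := ∑ k, wVar k * α k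

/-- The derivation `∑ zᵢ ∂/∂wᵢ`. -/
def shearDer (N : ℕ) : Derivation ℂ (PairPoly N) (PairPoly N) := ∑ i, zVar i • dw i

/-- The Euler derivation `∑ wᵢ ∂/∂wᵢ`. -/
def eulerDer (N : ℕ) : Derivation ℂ (PairPoly N) (PairPoly N) := ∑ i, wVar i • dw i

/-- The polynomial `(z, w)`. -/
def formZW (N : ℕ) : PairPoly N := ∑ i, zVar i * wVar i

/-- The polynomial `(z, z)`. -/
def formZZ (N : ℕ) : PairPoly N := ∑ i, zVar i * zVar i

/-- The polynomial `(w, w)`. -/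
def formWW (N : ℕ) : PairPoly N := ∑ i, wVar i * wVar i

/-- The scalar `¼ ((z, w)² - (z, z) (w, w))` by which the square of the bivector `z ∧ w` acts on the
plane spanned by `z` and `w`. -/
def bivNorm (N : ℕ) : PairPoly N :=
  (1 / 4 : ℂ) • (formZW N * formZW N - formZZ N * formWW N)

theorem shearDer_apply (f : PairPoly N) : shearDer N f = ∑ i, zVar i * dw i f := by
  rw [shearDer, ← Derivation.coeFnAddMonoidHom_apply, map_sum, Finset.sum_apply]
  rfl

theorem eulerDer_apply (f : PairPoly N) : eulerDer N f = ∑ i, wVar i * dw i f := by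
  rw [eulerDer, ← Derivation.coeFnAddMonoidHom_apply, map_sum, Finset.sum_apply]
  rfl

@[simp] theorem shearDer_zVar (j : Fin N) : shearDer N (zVar j) = 0 := by
  simp [shearDer_apply]

@[simp] theorem shearDer_wVar (j : Fin N) : shearDer N (wVar j) = zVar j := by
  simp [shearDer_apply]

@[simp] theorem eulerDer_zVar (j : Fin N) : eulerDer N (zVar j) = 0 := by
  simp [eulerDer_apply]

@[simp] theorem eulerDer_wVar (j : Fin N) : eulerDer N (wVar j) = wVar j := by
  simp [eulerDer_apply]

variable {A : Type*} [Ring A] [Algebra ℂ A]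

theorem derExt_shearDer (t : PairPoly N ⊗[ℂ] A) :
    derExt A (shearDer N) t = ∑ i, zVar i • derExt A (dw i) t := by
  induction t with
  | zero => simp
  | add x y hx hy => simp only [map_add, smul_add, Finset.sum_add_distrib, hx, hy]
  | tmul p a =>
    simp only [derExt_tmul, shearDer_apply, TensorProduct.sum_tmul, TensorProduct.smul_tmul',
      smul_eq_mul]

theorem derExt_eulerDer (t : PairPoly N ⊗[ℂ] A) :
    derExt A (eulerDer N) t = ∑ i, wVar i • derExt A (dw i) t := by
  induction t with
  | zero => simp
  | add x y hx hy => simp only [map_add, smul_add, Finset.sum_add_distrib, hx, hy]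
  | tmul p a =>
    simp only [derExt_tmul, eulerDer_apply, TensorProduct.sum_tmul, TensorProduct.smul_tmul',
      smul_eq_mul]

/-- The elements of `ℂ[z, w] ⊗ A` that are homogeneous of degree `d` in `w` and invariant under
`w ↦ w + c z`; the polynomials in the entries of the bivector `z ∧ w` that are homogeneous of
degree `d` are of this kind. -/
structure IsBivectorial (d : ℕ) (F : PairPoly N ⊗[ℂ] A) : Prop where
  shear : derExt A (shearDer N) F = 0
  euler : derExt A (eulerDer N) F = (d : ℂ) • F

theorem IsBivectorial.mul {d d' : ℕ} {F G : PairPoly N ⊗[ℂ] A} (hF : IsBivectorial d F)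
    (hG : IsBivectorial d' G) : IsBivectorial (d + d') (F * G) where
  shear := by rw [derExt_mul, hF.shear, hG.shear, zero_mul, mul_zero, add_zero]
  euler := by
    rw [derExt_mul, hF.euler, hG.euler, smul_mul_assoc, mul_smul_comm, ← add_smul, Nat.cast_add]

theorem IsBivectorial.add {d : ℕ} {F G : PairPoly N ⊗[ℂ] A} (hF : IsBivectorial d F)
    (hG : IsBivectorial d G) : IsBivectorial d (F + G) where
  shear := by rw [map_add, hF.shear, hG.shear, add_zero]
  euler := by rw [map_add, hF.euler, hG.euler, smul_add]

theorem IsBivectorial.smul {d : ℕ} {F : PairPoly N ⊗[ℂ] A} (hF : IsBivectorial d F) (c : ℂ) :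
    IsBivectorial d (c • F) where
  shear := by rw [map_smul, hF.shear, smul_zero]
  euler := by rw [map_smul, hF.euler, smul_comm]

theorem shearDer_bivNorm : shearDer N (bivNorm N) = 0 := by
  simp only [bivNorm, formZW, formZZ, formWW, Derivation.map_smul, map_sub, Derivation.leibniz, map_sum,
    shearDer_zVar, shearDer_wVar, smul_eq_mul, mul_zero, add_zero, Finset.sum_const_zero]
  simp only [mul_comm (wVar _) (zVar _), Finset.sum_add_distrib]
  rw [smul_eq_zero]
  right
  ring

theorem eulerDer_bivNorm : eulerDer N (bivNorm N) = (2 : ℂ) • bivNorm N := by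
  simp only [bivNorm, formZW, formZZ, formWW, Derivation.map_smul, map_sub, Derivation.leibniz, map_sum,
    eulerDer_zVar, eulerDer_wVar, smul_eq_mul, mul_zero, add_zero, Finset.sum_const_zero]
  rw [smul_comm, two_smul ℂ, Finset.sum_add_distrib]
  exact congrArg ((1 / 4 : ℂ) • ·) (by ring)

theorem IsBivectorial.bivNorm_smul {d : ℕ} {F : PairPoly N ⊗[ℂ] A} (hF : IsBivectorial d F) :
    IsBivectorial (d + 2) (bivNorm N • F) where
  shear := by rw [derExt_smul, hF.shear, shearDer_bivNorm, smul_zero, zero_smul, add_zero]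
  euler := by
    rw [derExt_smul, hF.euler, eulerDer_bivNorm, smul_comm _ (d : ℂ), smul_assoc, ← add_smul,
      Nat.cast_add, add_comm (2 : ℂ), Nat.cast_ofNat]

theorem gaussExt_formZW_smul (G : PairPoly N ⊗[ℂ] A) : gaussExt N A (formZW N • G) =
    (N : ℂ) • gaussExt N A G + gaussExt N A (derExt A (eulerDer N) G) := by
  simp only [formZW, Finset.sum_smul, map_sum, mul_smul, gaussExt_zVar_smul, derExt_smul, dw_wVar,
    if_true, one_smul, map_add, Finset.sum_add_distrib, derExt_eulerDer]
  rw [Finset.sum_const, Finset.card_univ, Fintype.card_fin, Nat.cast_smul_eq_nsmul]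

theorem gaussExt_formZZ_smul (G : PairPoly N ⊗[ℂ] A) : gaussExt N A (formZZ N • G) =
    gaussExt N A (derExt A (shearDer N) G) := by
  simp only [formZZ, Finset.sum_smul, map_sum, mul_smul, gaussExt_zVar_smul, derExt_smul, dw_zVar,
    zero_smul, zero_add, derExt_shearDer]

/-- On a bivectorial polynomial of degree `d` the scalar `λ = ¼ ((z, w)² - (z, z)(w, w))` acts, inside
Gaussian moments, as the number `(N + d) (N + d - 1) / 4`. This is the analogue of the Cayley
identity: each of the two products in `λ` is integrated by parts in `z`. -/
theorem IsBivectorial.gaussExt_bivNorm_smul {d : ℕ} {F : PairPoly N ⊗[ℂ] A}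
    (hF : IsBivectorial d F) : gaussExt N A (bivNorm N • F) =
      (((N : ℂ) + d) * ((N : ℂ) + d - 1) / 4) • gaussExt N A F := by
  have h1 : gaussExt N A (formZW N • F) = ((N : ℂ) + d) • gaussExt N A F := by
    rw [gaussExt_formZW_smul, hF.euler, map_smul, ← add_smul]
  have e1 : eulerDer N (formZW N) = formZW N := by
    simp [formZW]
  have e2 : shearDer N (formWW N) = (2 : ℂ) • formZW N := by
    simp only [formZW, formWW, map_sum, Derivation.leibniz, shearDer_wVar, smul_eq_mul,
      Finset.sum_add_distrib, two_smul, mul_comm (wVar _)]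
  have h2 : gaussExt N A (formZW N • formZW N • F) =
      (((N : ℂ) + d + 1) * ((N : ℂ) + d)) • gaussExt N A F := by
    rw [gaussExt_formZW_smul, derExt_smul, e1, hF.euler, map_add, smul_comm _ (d : ℂ),
      (gaussExt N A).map_smul (d : ℂ), h1, smul_smul, smul_smul, ← add_smul, ← add_smul]
    congr 1
    ring
  have h3 : gaussExt N A (formZZ N • formWW N • F) =
      (2 * ((N : ℂ) + d)) • gaussExt N A F := by
    rw [gaussExt_formZZ_smul, derExt_smul, e2, hF.shear, smul_zero, add_zero, smul_assoc,
      (gaussExt N A).map_smul (2 : ℂ), h1, smul_smul]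
  have h4 : (formZW N * formZW N - formZZ N * formWW N) • F =
      formZW N • formZW N • F - formZZ N • formWW N • F := by
    rw [← mul_smul, ← mul_smul, eq_sub_iff_add_eq, ← add_smul, sub_add_cancel]
  rw [bivNorm, smul_assoc, h4, (gaussExt N A).map_smul, map_sub, h2, h3,
    ← sub_smul, smul_smul]
  congr 1
  ring

/-- The normalization `c_d = (N + d - 2)! / 2^d` of Gaussian moments of bivectorial polynomials of
degree `d`. Up to a factor that depends only on `N`, it is the moment of `λ^(d/2)`, with `λ` as in
`bivNorm`. The subtraction truncates only for `N + d < 2`, where the value plays no role. -/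
def bivMoment (N d : ℕ) : ℂ := ((N + d - 2).factorial : ℂ) / 2 ^ d

theorem bivMoment_ne_zero (N d : ℕ) : bivMoment N d ≠ 0 :=
  div_ne_zero (Nat.cast_ne_zero.2 (Nat.factorial_ne_zero _)) (by simp)

theorem bivMoment_add_two {N d : ℕ} (h : 2 ≤ N + d) : bivMoment N (d + 2) =
    ((N : ℂ) + d) * ((N : ℂ) + d - 1) / 4 * bivMoment N d := by
  obtain ⟨k, hk⟩ := Nat.exists_eq_add_of_le h
  have h1 : N + (d + 2) - 2 = k + 2 := by omega
  have h2 : N + d - 2 = k := by omega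
  have h3 : (N : ℂ) + d = k + 2 := by
    have := congrArg (fun n : ℕ => (n : ℂ)) hk
    push_cast at this
    rw [this, add_comm]
  rw [bivMoment, bivMoment, h1, h2, h3, Nat.factorial_succ, Nat.factorial_succ, pow_add]
  push_cast
  field_simp
  ring

theorem IsBivectorial.gaussExt_bivNorm_pow_smul {d : ℕ} (hd : 2 ≤ N + d)
    {F : PairPoly N ⊗[ℂ] A} (hF : IsBivectorial d F) (k : ℕ) :
    gaussExt N A (bivNorm N ^ k • F) =
      (bivMoment N (d + 2 * k) / bivMoment N d) • gaussExt N A F := by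
  have hk : IsBivectorial (d + 2 * k) (bivNorm N ^ k • F) ∧ gaussExt N A (bivNorm N ^ k • F) =
      (bivMoment N (d + 2 * k) / bivMoment N d) • gaussExt N A F := by
    induction k with
    | zero => simpa [bivMoment_ne_zero] using hF
    | succ k ih =>
      rw [pow_succ', mul_smul]
      refine ⟨ih.1.bivNorm_smul, ?_⟩
      rw [ih.1.gaussExt_bivNorm_smul, ih.2, smul_smul,
        show d + 2 * (k + 1) = d + 2 * k + 2 by ring, bivMoment_add_two (by omega)]
      congr 1
      push_cast
      ring
  exact hk.2

end Bivector

/-! ### The action of a bivector on vectors -/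

section Action

variable {N : ℕ} {A : Type*} [Ring A] [Algebra ℂ A]

/-- The vector `∑ αₖ ⊗ xₖ`, for elements `xₖ` of an algebra. -/
def vecForm (x : Fin N → A) (α : Fin N → PairPoly N) : PairPoly N ⊗[ℂ] A := ∑ k, α k ⊗ₜ x k

/-- The relations of `𝔰𝔬_N ⋉ V_N` between the elements `eᵢⱼ = (E_{ji} - E_{ij}) / 2` of `𝔰𝔬_N` and
the basis vectors `xₖ` of `V_N`, in an algebra. -/
structure IsRotationPair (e : Matrix (Fin N) (Fin N) A) (x : Fin N → A) : Prop where
  skew : ∀ i j, e j i = -e i j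
  comm : ∀ i j k, e i j * x k - x k * e i j =
    (1 / 2 : ℂ) • ((if i = k then x j else 0) - if j = k then x i else 0)

/-- The vector `½ ((w, α) z - (z, α) w)`, the result of applying the bivector `z ∧ w` to `α`. -/
def bivAct (α : Fin N → PairPoly N) (k : Fin N) : PairPoly N :=
  (1 / 2 : ℂ) • (wDot α * zVar k - zDot α * wVar k)

theorem IsRotationPair.pairForm_mul_vecForm_sub {e : Matrix (Fin N) (Fin N) A} {x : Fin N → A}
    (h : IsRotationPair e x) (α : Fin N → PairPoly N) :
    pairForm e * vecForm x α - vecForm x α * pairForm e = vecForm x (bivAct α) := by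
  have h1 : pairForm e * vecForm x α - vecForm x α * pairForm e =
      ∑ i, ∑ j, ∑ k, (wVar i * zVar j * α k) ⊗ₜ[ℂ]
        ((1 / 2 : ℂ) • ((if i = k then x j else 0) - if j = k then x i else 0)) := by
    simp_rw [← h.comm, TensorProduct.tmul_sub, Finset.sum_sub_distrib]
    refine congrArg₂ (· - ·) ?_ ?_
    · rw [pairForm, vecForm, Finset.sum_mul]
      refine Finset.sum_congr rfl fun i _ => ?_
      rw [Finset.sum_mul]
      refine Finset.sum_congr rfl fun j _ => ?_
      rw [Finset.mul_sum]
      exact Finset.sum_congr rfl fun k _ => Algebra.TensorProduct.tmul_mul_tmul _ _ _ _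
    · rw [pairForm, vecForm, Finset.mul_sum]
      refine Finset.sum_congr rfl fun i _ => ?_
      rw [Finset.mul_sum]
      refine Finset.sum_congr rfl fun j _ => ?_
      rw [Finset.sum_mul]
      refine Finset.sum_congr rfl fun k _ => ?_
      rw [Algebra.TensorProduct.tmul_mul_tmul, mul_comm (α k)]
  rw [h1]
  have h2 : ∀ i j k : Fin N, (wVar i * zVar j * α k) ⊗ₜ[ℂ]
      ((1 / 2 : ℂ) • ((if i = k then x j else 0) - if j = k then x i else 0)) =
      (if i = k then ((1 / 2 : ℂ) • (wVar i * α k * zVar j)) ⊗ₜ[ℂ] x j else 0) -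
        if j = k then ((1 / 2 : ℂ) • (zVar j * α k * wVar i)) ⊗ₜ[ℂ] x i else 0 := by
    intro i j k
    rw [TensorProduct.tmul_smul, TensorProduct.tmul_sub, smul_sub]
    refine congrArg₂ (· - ·) ?_ ?_
    · split_ifs
      · rw [← TensorProduct.smul_tmul', mul_right_comm]
      · simp
    · split_ifs
      · rw [← TensorProduct.smul_tmul', mul_assoc, mul_comm]
      · simp
  simp_rw [h2, Finset.sum_sub_distrib, vecForm, bivAct, smul_sub, TensorProduct.sub_tmul,
    Finset.sum_sub_distrib]
  refine congrArg₂ (· - ·) ?_ ?_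
  · rw [Finset.sum_comm]
    refine Finset.sum_congr rfl fun j _ => ?_
    simp_rw [Finset.sum_ite_eq, Finset.mem_univ, if_true]
    rw [← TensorProduct.sum_tmul, ← Finset.smul_sum, wDot, Finset.sum_mul]
  · refine Finset.sum_congr rfl fun i _ => ?_
    simp_rw [Finset.sum_ite_eq, Finset.mem_univ, if_true]
    rw [← TensorProduct.sum_tmul, ← Finset.smul_sum, zDot, Finset.sum_mul]

theorem wDot_bivAct (α : Fin N → PairPoly N) :
    wDot (bivAct α) = (1 / 2 : ℂ) • (wDot α * formZW N - zDot α * formWW N) := by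
  have h : ∀ k, wVar k * bivAct α k =
      (1 / 2 : ℂ) • (wDot α * (zVar k * wVar k) - zDot α * (wVar k * wVar k)) := fun k => by
    rw [bivAct, mul_smul_comm]
    exact congrArg ((1 / 2 : ℂ) • ·) (by ring)
  rw [wDot, Finset.sum_congr rfl fun k _ => h k, ← Finset.smul_sum, Finset.sum_sub_distrib,
    ← Finset.mul_sum, ← Finset.mul_sum, formZW, formWW]

theorem zDot_bivAct (α : Fin N → PairPoly N) :
    zDot (bivAct α) = (1 / 2 : ℂ) • (wDot α * formZZ N - zDot α * formZW N) := by
  have h : ∀ k, zVar k * bivAct α k =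
      (1 / 2 : ℂ) • (wDot α * (zVar k * zVar k) - zDot α * (zVar k * wVar k)) := fun k => by
    rw [bivAct, mul_smul_comm]
    exact congrArg ((1 / 2 : ℂ) • ·) (by ring)
  rw [zDot, Finset.sum_congr rfl fun k _ => h k, ← Finset.smul_sum, Finset.sum_sub_distrib,
    ← Finset.mul_sum, ← Finset.mul_sum, formZZ, formZW]

/-- On the plane spanned by `z` and `w`, the bivector `z ∧ w` acts with a scalar square. -/
theorem bivAct_bivAct_bivAct (α : Fin N → PairPoly N) :
    bivAct (bivAct (bivAct α)) = fun k => bivNorm N * bivAct α k := by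
  funext k
  rw [bivAct, wDot_bivAct (bivAct α), zDot_bivAct (bivAct α), wDot_bivAct α, zDot_bivAct α,
    bivAct, bivNorm]
  simp only [MvPolynomial.smul_eq_C_mul]
  have h4 : (MvPolynomial.C (1 / 4 : ℂ) : PairPoly N) =
      MvPolynomial.C (1 / 2 : ℂ) * MvPolynomial.C (1 / 2 : ℂ) := by
    rw [← map_mul]; norm_num
  rw [h4]
  ring

theorem vecForm_mul_left (x : Fin N → A) (p : PairPoly N) (α : Fin N → PairPoly N) :
    vecForm x (fun k => p * α k) = p • vecForm x α := by
  simp [vecForm, Finset.smul_sum, TensorProduct.smul_tmul']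

theorem isBivectorial_pairForm {e : Matrix (Fin N) (Fin N) A} (h : ∀ i j, e j i = -e i j) :
    IsBivectorial 1 (pairForm e) where
  shear := by
    have h1 : derExt A (shearDer N) (pairForm e) = ∑ i, ∑ j, (zVar i * zVar j) ⊗ₜ[ℂ] e i j := by
      simp [pairForm, Derivation.leibniz, mul_comm]
    have h2 : ∑ i, ∑ j, (zVar i * zVar j) ⊗ₜ[ℂ] e i j =
        -∑ i, ∑ j, (zVar i * zVar j) ⊗ₜ[ℂ] e i j := by
      conv_lhs => rw [Finset.sum_comm]
      simp_rw [← Finset.sum_neg_distrib, ← TensorProduct.tmul_neg, ← h]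
      exact Finset.sum_congr rfl fun i _ => Finset.sum_congr rfl fun j _ => by
        rw [mul_comm]
    have h3 : (2 : ℂ) • ∑ i, ∑ j, (zVar i * zVar j) ⊗ₜ[ℂ] e i j = 0 := by
      rw [two_smul]
      nth_rewrite 1 [h2]
      exact neg_add_cancel _
    rw [h1]
    exact (smul_eq_zero_iff_right (two_ne_zero' ℂ)).1 h3
  euler := by simp [pairForm, Derivation.leibniz, mul_comm]

theorem isBivectorial_vecForm_bivAct (x : Fin N → A) (y : Fin N → ℂ) :
    IsBivectorial 1 (vecForm x (bivAct fun k => MvPolynomial.C (y k))) where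
  shear := by
    have h : ∀ k, shearDer N (bivAct (fun k => MvPolynomial.C (y k)) k) = 0 := by
      intro k
      simp only [bivAct, wDot, zDot, Derivation.map_smul, map_sub, Derivation.leibniz, map_sum,
        shearDer_zVar, shearDer_wVar, MvPolynomial.derivation_C, smul_eq_mul, mul_zero, add_zero,
        zero_add, Finset.sum_const_zero]
      rw [smul_eq_zero]
      right
      rw [sub_eq_zero, Finset.mul_sum, Finset.sum_mul]
      exact Finset.sum_congr rfl fun k _ => by ring
    simp [vecForm, h]
  euler := by
    have h : ∀ k, eulerDer N (bivAct (fun k => MvPolynomial.C (y k)) k) =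
        bivAct (fun k => MvPolynomial.C (y k)) k := by
      intro k
      simp only [bivAct, wDot, zDot, Derivation.map_smul, map_sub, Derivation.leibniz, map_sum,
        eulerDer_zVar, eulerDer_wVar, MvPolynomial.derivation_C, smul_eq_mul, mul_zero, add_zero,
        zero_add, Finset.sum_const_zero]
      refine congrArg ((1 / 2 : ℂ) • ·) (congrArg (· - _) ?_)
      rw [Finset.mul_sum, Finset.sum_mul]
      exact Finset.sum_congr rfl fun k _ => by ring
    simp [vecForm, h]

end Action

/-! ### Commutators and anticommutators with powers -/

section Symmetric

variable {T B : Type*} [Ring T] [Algebra ℂ T] [AddCommGroup B] [Module ℂ B]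

/-- The operator `t ↦ ½ (X t + t X)`. -/
def symOp (X : T) : Module.End ℂ T :=
  (1 / 2 : ℂ) • (LinearMap.mulLeft ℂ X + LinearMap.mulRight ℂ X)

/-- The operator `t ↦ ½ (X t - t X)`. -/
def altOp (X : T) : Module.End ℂ T :=
  (1 / 2 : ℂ) • (LinearMap.mulLeft ℂ X - LinearMap.mulRight ℂ X)

theorem symOp_apply (X t : T) : symOp X t = (1 / 2 : ℂ) • (X * t + t * X) := rfl

theorem altOp_apply (X t : T) : altOp X t = (1 / 2 : ℂ) • (X * t - t * X) := rfl

theorem symOp_add_altOp (X : T) : symOp X + altOp X = LinearMap.mulLeft ℂ X := by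
  rw [symOp, altOp, ← smul_add, add_add_sub_cancel, ← two_smul ℂ, smul_smul]
  norm_num

theorem symOp_sub_altOp (X : T) : symOp X + -altOp X = LinearMap.mulRight ℂ X := by
  refine LinearMap.ext fun t => ?_
  change symOp X t + -altOp X t = t * X
  rw [symOp_apply, altOp_apply]
  module

theorem commute_symOp_altOp (X : T) : Commute (symOp X) (altOp X) := by
  have h : Commute (LinearMap.mulLeft ℂ X) (LinearMap.mulRight ℂ X) :=
    LinearMap.commute_mulLeft_right X X
  exact ((((Commute.refl _).sub_right h).add_left
    (h.symm.sub_right (Commute.refl _))).smul_right _).smul_left _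

theorem pow_mul_eq_sum (X t : T) (n : ℕ) : X ^ n * t = ∑ i ∈ Finset.range (n + 1),
    (n.choose i : ℂ) • (symOp X ^ i) ((altOp X ^ (n - i)) t) := by
  have h := congrArg (fun f : Module.End ℂ T => f t) ((commute_symOp_altOp X).add_pow n)
  simp only [symOp_add_altOp, LinearMap.pow_mulLeft, LinearMap.mulLeft_apply,
    LinearMap.sum_apply] at h
  rw [h]
  refine Finset.sum_congr rfl fun i _ => ?_
  rw [← Nat.cast_comm, ← nsmul_eq_mul, LinearMap.smul_apply, Module.End.mul_apply,
    Nat.cast_smul_eq_nsmul]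

theorem mul_pow_eq_sum (X t : T) (n : ℕ) : t * X ^ n = ∑ i ∈ Finset.range (n + 1),
    ((-1) ^ (n - i) * (n.choose i : ℂ)) • (symOp X ^ i) ((altOp X ^ (n - i)) t) := by
  have h := congrArg (fun f : Module.End ℂ T => f t)
    ((commute_symOp_altOp X).neg_right.add_pow n)
  simp only [symOp_sub_altOp, LinearMap.pow_mulRight, LinearMap.mulRight_apply,
    LinearMap.sum_apply] at h
  rw [h]
  refine Finset.sum_congr rfl fun i _ => ?_
  rw [← Nat.cast_comm, ← nsmul_eq_mul, LinearMap.smul_apply, Module.End.mul_apply,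
    ← Nat.cast_smul_eq_nsmul ℂ, neg_pow, mul_comm _ (n.choose i : ℂ), mul_smul]
  congr 1
  rcases Nat.even_or_odd (n - i) with hp | hp <;> simp [hp.neg_one_pow]

/-- The linear functional `s^k ↦ c_{k+1}⁻¹ E(S^k u)` on polynomials in one variable, where `S` is
half the anticommutator with `X`. -/
def umbral (c : ℕ → ℂ) (E : T →ₗ[ℂ] B) (X u : T) : Polynomial ℂ →ₗ[ℂ] B :=
  Polynomial.lsum fun k => LinearMap.toSpanSingleton ℂ B ((c (k + 1))⁻¹ • E ((symOp X ^ k) u))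

theorem umbral_monomial (c : ℕ → ℂ) (E : T →ₗ[ℂ] B) (X u : T) (k : ℕ) (b : ℂ) :
    umbral c E X u (Polynomial.monomial k b) = b • (c (k + 1))⁻¹ • E ((symOp X ^ k) u) := by
  simp [umbral]

theorem umbral_add_pow (c : ℕ → ℂ) (E : T →ₗ[ℂ] B) (X u : T) (n : ℕ) (b : ℂ) :
    umbral c E X u ((Polynomial.X + Polynomial.C b) ^ n) = ∑ i ∈ Finset.range (n + 1),
      (b ^ (n - i) * (n.choose i : ℂ) * (c (i + 1))⁻¹) • E ((symOp X ^ i) u) := by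
  rw [add_pow, map_sum]
  refine Finset.sum_congr rfl fun i _ => ?_
  have h : (Polynomial.X : Polynomial ℂ) ^ i * Polynomial.C b ^ (n - i) * (n.choose i : Polynomial ℂ) =
      Polynomial.monomial i (b ^ (n - i) * (n.choose i : ℂ)) := by
    rw [← Polynomial.C_mul_X_pow_eq_monomial, map_mul, map_pow, map_natCast]
    ring
  rw [h, umbral_monomial, smul_smul]

variable {c : ℕ → ℂ} {E : T →ₗ[ℂ] B} {X Y u : T}

/-- If even powers of the commutator with `X` act on the moments `E(S^m u)` by scalars, then the
moments of `X^n u + u X^n` are given by a finite difference operator on polynomials. -/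
theorem map_pow_mul_add (hE : ∀ m k, E ((symOp X ^ m) ((altOp X ^ (2 * k)) u)) =
      ((1 / 2) ^ (2 * k) * c (m + 1 + 2 * k) * (c (m + 1))⁻¹) • E ((symOp X ^ m) u)) (n : ℕ) :
    E (X ^ n * u + u * X ^ n) = c (n + 1) •
      umbral c E X u ((Polynomial.X + Polynomial.C (1 / 2)) ^ n +
        (Polynomial.X + Polynomial.C (-1 / 2)) ^ n) := by
  rw [map_add (umbral c E X u), umbral_add_pow, umbral_add_pow, pow_mul_eq_sum, mul_pow_eq_sum,
    ← Finset.sum_add_distrib, ← Finset.sum_add_distrib, map_sum, Finset.smul_sum]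
  refine Finset.sum_congr rfl fun i hi => ?_
  rw [← add_smul, ← add_smul, map_smul, smul_smul]
  have hi' : i ≤ n := Nat.lt_succ_iff.1 (Finset.mem_range.1 hi)
  rw [show (-1 / 2 : ℂ) = -(1 / 2) by norm_num]
  rcases Nat.even_or_odd (n - i) with hp | hp
  · rw [hp.neg_one_pow, hp.neg_pow]
    obtain ⟨k, hk⟩ := hp
    have hk2 : n - i = 2 * k := by omega
    have hn : i + 1 + 2 * k = n + 1 := by omega
    rw [hk2, hE, hn, smul_smul]
    congr 1
    ring
  · rw [hp.neg_one_pow, hp.neg_pow]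
    simp

/-- The moments of `X^n Y - Y X^n` are given by a finite difference operator on polynomials, with
`u = [X, Y]`. -/
theorem map_pow_mul_sub (hu : X * Y - Y * X = u)
    (hE : ∀ m k, E ((symOp X ^ m) ((altOp X ^ (2 * k)) u)) =
      ((1 / 2) ^ (2 * k) * c (m + 1 + 2 * k) * (c (m + 1))⁻¹) • E ((symOp X ^ m) u)) (n : ℕ) :
    E (X ^ n * Y - Y * X ^ n) = c n •
      umbral c E X u ((Polynomial.X + Polynomial.C (1 / 2)) ^ n -
        (Polynomial.X + Polynomial.C (-1 / 2)) ^ n) := by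
  rw [map_sub (umbral c E X u), umbral_add_pow, umbral_add_pow, pow_mul_eq_sum, mul_pow_eq_sum,
    ← Finset.sum_sub_distrib, ← Finset.sum_sub_distrib, map_sum, Finset.smul_sum]
  refine Finset.sum_congr rfl fun i hi => ?_
  rw [← sub_smul, ← sub_smul, map_smul, smul_smul]
  have hi' : i ≤ n := Nat.lt_succ_iff.1 (Finset.mem_range.1 hi)
  rw [show (-1 / 2 : ℂ) = -(1 / 2) by norm_num]
  rcases Nat.even_or_odd (n - i) with hp | hp
  · rw [hp.neg_one_pow, hp.neg_pow]
    simp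
  · rw [hp.neg_one_pow, hp.neg_pow]
    obtain ⟨k, hk⟩ := hp
    have hn : i + 1 + 2 * k = n := by omega
    have hY : altOp X Y = (1 / 2 : ℂ) • u := by rw [altOp_apply, hu]
    rw [hk, pow_succ (altOp X), Module.End.mul_apply, hY, map_smul, map_smul, map_smul, hE, hn,
      smul_smul, smul_smul, pow_succ (1 / 2 : ℂ)]
    congr 1
    ring

end Symmetric

section RotationMoments

variable {N : ℕ} {A : Type*} [Ring A] [Algebra ℂ A] {e : Matrix (Fin N) (Fin N) A} {x : Fin N → A}

theorem symOp_smul (X t : PairPoly N ⊗[ℂ] A) (p : PairPoly N) :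
    symOp X (p • t) = p • symOp X t := by
  rw [symOp_apply, symOp_apply, mul_smul_comm, smul_mul_assoc, ← smul_add, smul_comm]

theorem symOp_pow_smul (X t : PairPoly N ⊗[ℂ] A) (p : PairPoly N) (m : ℕ) :
    (symOp X ^ m) (p • t) = p • (symOp X ^ m) t := by
  induction m with
  | zero => rfl
  | succ m ih => rw [pow_succ', Module.End.mul_apply, Module.End.mul_apply, ih, symOp_smul]

theorem altOp_smul (X t : PairPoly N ⊗[ℂ] A) (p : PairPoly N) :
    altOp X (p • t) = p • altOp X t := by
  have h : X * p • t - p • t * X = p • (X * t - t * X) := by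
    rw [mul_smul_comm, smul_mul_assoc, sub_eq_iff_eq_add, ← smul_add, sub_add_cancel]
  rw [altOp_apply, altOp_apply, h, smul_comm]

theorem IsBivectorial.symOp_pow {F : PairPoly N ⊗[ℂ] A} {d : ℕ} (hF : IsBivectorial d F)
    {X : PairPoly N ⊗[ℂ] A} (hX : IsBivectorial 1 X) (m : ℕ) :
    IsBivectorial (m + d) ((symOp X ^ m) F) := by
  induction m with
  | zero => simpa using hF
  | succ m ih =>
    rw [pow_succ', Module.End.mul_apply, symOp_apply]
    have h1 := hX.mul ih
    have h2 := ih.mul hX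
    rw [show 1 + (m + d) = m + 1 + d by ring] at h1
    rw [show m + d + 1 = m + 1 + d by ring] at h2
    exact (h1.add h2).smul _

/-- The vector `y ∈ V_N`, with coefficients in the algebra. -/
def constVec (y : Fin N → ℂ) (k : Fin N) : PairPoly N := MvPolynomial.C (y k)

/-- `H^(2k) u = 4^(-k) λ^k u`, for `H` half the commutator with `X` and `u = [X, y]`. -/
theorem altOp_pow_vecForm_bivAct (h : IsRotationPair e x) (y : Fin N → ℂ) (k : ℕ) :
    (altOp (pairForm e) ^ (2 * k)) (vecForm x (bivAct (constVec y))) =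
      ((1 / 2 : ℂ) ^ (2 * k)) • bivNorm N ^ k • vecForm x (bivAct (constVec y)) := by
  induction k with
  | zero => simp
  | succ k ih =>
    have h2 : (altOp (pairForm e) ^ 2) (vecForm x (bivAct (constVec y))) =
        ((1 / 2 : ℂ) ^ 2) • bivNorm N • vecForm x (bivAct (constVec y)) := by
      rw [pow_two, Module.End.mul_apply, altOp_apply _ (vecForm x _), h.pairForm_mul_vecForm_sub,
        map_smul, altOp_apply, h.pairForm_mul_vecForm_sub, bivAct_bivAct_bivAct,
        vecForm_mul_left, smul_smul, pow_two (1 / 2 : ℂ)]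
    have hs : ∀ (j : ℕ) (t : PairPoly N ⊗[ℂ] A),
        (altOp (pairForm e) ^ j) (bivNorm N • t) = bivNorm N • (altOp (pairForm e) ^ j) t := by
      intro j t
      induction j with
      | zero => rfl
      | succ j ih => rw [pow_succ', Module.End.mul_apply, Module.End.mul_apply, ih, altOp_smul]
    rw [mul_add, mul_one, pow_add, Module.End.mul_apply, h2, map_smul, hs, ih,
      smul_comm (bivNorm N) ((1 / 2 : ℂ) ^ (2 * k)), smul_smul, smul_smul, pow_succ' (bivNorm N),
      pow_add, mul_comm]

/-- For the universal bivector `X` and `u = [X, y]`, even powers of the commutator with `X` change the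
moment of `S^m u` only by the ratio of the normalizations `c_d`. -/
theorem gaussExt_symOp_altOp (hN : 1 ≤ N) (h : IsRotationPair e x) (y : Fin N → ℂ) (m k : ℕ) :
    gaussExt N A ((symOp (pairForm e) ^ m)
      ((altOp (pairForm e) ^ (2 * k)) (vecForm x (bivAct (constVec y))))) =
      ((1 / 2) ^ (2 * k) * bivMoment N (m + 1 + 2 * k) * (bivMoment N (m + 1))⁻¹) •
        gaussExt N A ((symOp (pairForm e) ^ m) (vecForm x (bivAct (constVec y)))) := by
  have hb : IsBivectorial (m + 1) ((symOp (pairForm e) ^ m) (vecForm x (bivAct (constVec y)))) :=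
    IsBivectorial.symOp_pow (isBivectorial_vecForm_bivAct x y) (isBivectorial_pairForm h.skew) m
  rw [altOp_pow_vecForm_bivAct h, map_smul, map_smul, symOp_pow_smul,
    hb.gaussExt_bivNorm_pow_smul (by omega), smul_smul, div_eq_mul_inv (bivMoment _ _),
    mul_assoc]

end RotationMoments

/-! ### The constants -/

section Constants

theorem sum_range_even_odd {M : Type*} [AddCommMonoid M] (f : ℕ → M) (q : ℕ) :
    ∑ i ∈ Finset.range (2 * q + 1), f i =
      ∑ j ∈ Finset.range (q + 1), f (2 * j) + ∑ j ∈ Finset.range q, f (2 * j + 1) := by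
  induction q with
  | zero => simp
  | succ q ih =>
    rw [show 2 * (q + 1) + 1 = 2 * q + 1 + 1 + 1 by ring, Finset.sum_range_succ,
      Finset.sum_range_succ, ih, Finset.sum_range_succ _ (q + 1),
      Finset.sum_range_succ (fun j => f (2 * j + 1)), show 2 * (q + 1) = 2 * q + 1 + 1 by ring]
    abel

/-- If `P = Q + 1`, then `(1 - P)^(2q) - (1 + Q)^(2q) = Q^(2q) - P^(2q)`; this is the expansion of
the left-hand side, separated into even and odd powers. -/
theorem binomial_difference {R : Type*} [CommRing R] {P Q : R} (h : P = Q + 1) (q : ℕ) :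
    (P ^ (2 * q) - Q ^ (2 * q)) +
        ∑ j ∈ Finset.range (q + 1), ((2 * q).choose (2 * j) : R) * (P ^ (2 * j) - Q ^ (2 * j)) =
      ∑ j ∈ Finset.range q,
        ((2 * q).choose (2 * j + 1) : R) * (P ^ (2 * j + 1) + Q ^ (2 * j + 1)) := by
  have h1 : ∑ i ∈ Finset.range (2 * q + 1), ((2 * q).choose i : R) * ((-P) ^ i - Q ^ i) =
      Q ^ (2 * q) - P ^ (2 * q) := by
    have e1 : (-P + 1) ^ (2 * q) = Q ^ (2 * q) := by
      rw [h, show -(Q + 1) + 1 = -Q by ring, (even_two_mul q).neg_pow]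
    have e2 : (Q + 1) ^ (2 * q) = P ^ (2 * q) := by rw [h]
    rw [← e1, ← e2, add_pow, add_pow, ← Finset.sum_sub_distrib]
    exact Finset.sum_congr rfl fun i _ => by rw [one_pow]; ring
  rw [sum_range_even_odd] at h1
  have h2 : ∀ j, (-P) ^ (2 * j) = P ^ (2 * j) := fun j => (even_two_mul j).neg_pow P
  have h3 : ∀ j, (-P) ^ (2 * j + 1) - Q ^ (2 * j + 1) = -(P ^ (2 * j + 1) + Q ^ (2 * j + 1)) := by
    intro j
    rw [(odd_two_mul_add_one j).neg_pow]
    ring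
  simp only [h2, h3, mul_neg, Finset.sum_neg_distrib] at h1
  linear_combination h1

theorem sum_range_sum_Icc {M : Type*} [AddCommMonoid M] (m : ℕ) (F : ℕ → ℕ → M) :
    ∑ j ∈ Finset.range (m + 1), ∑ l ∈ Finset.Icc 1 (m + 1 - j), F j l =
      ∑ q ∈ Finset.Icc 1 (m + 1), ∑ j ∈ Finset.range q, F j (q - j) := by
  rw [Finset.sum_sigma', Finset.sum_sigma']
  refine Finset.sum_bij' (fun a _ => ⟨a.1 + a.2, a.1⟩) (fun a _ => ⟨a.2, a.1 - a.2⟩) ?_ ?_ ?_ ?_ ?_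
  · rintro ⟨j, l⟩ h
    simp only [Finset.mem_sigma, Finset.mem_range, Finset.mem_Icc] at h ⊢
    omega
  · rintro ⟨q, j⟩ h
    simp only [Finset.mem_sigma, Finset.mem_range, Finset.mem_Icc] at h ⊢
    omega
  · rintro ⟨j, l⟩ _
    simp
  · rintro ⟨q, j⟩ h
    simp only [Finset.mem_sigma, Finset.mem_range, Finset.mem_Icc] at h
    have : j + (q - j) = q := by omega
    simp [this]
  · rintro ⟨j, l⟩ _
    simp

theorem sum_Icc_sum_Icc {M : Type*} [AddCommMonoid M] (m : ℕ) (F : ℕ → ℕ → M) :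
    ∑ j ∈ Finset.Icc 1 (m + 1), ∑ l ∈ Finset.Icc 1 (m + 1 - j), F j l =
      ∑ q ∈ Finset.Icc 1 (m + 1), ∑ j ∈ Finset.Ico 1 q, F j (q - j) := by
  rw [Finset.sum_sigma', Finset.sum_sigma']
  refine Finset.sum_bij' (fun a _ => ⟨a.1 + a.2, a.1⟩) (fun a _ => ⟨a.2, a.1 - a.2⟩) ?_ ?_ ?_ ?_ ?_
  · rintro ⟨j, l⟩ h
    simp only [Finset.mem_sigma, Finset.mem_Ico, Finset.mem_Icc] at h ⊢
    omega
  · rintro ⟨q, j⟩ h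
    simp only [Finset.mem_sigma, Finset.mem_Ico, Finset.mem_Icc] at h ⊢
    omega
  · rintro ⟨j, l⟩ _
    simp
  · rintro ⟨q, j⟩ h
    simp only [Finset.mem_sigma, Finset.mem_Ico, Finset.mem_Icc] at h
    have : j + (q - j) = q := by omega
    simp [this]
  · rintro ⟨j, l⟩ _
    simp

variable {R : Type*} [CommRing R] {P Q : R}

/-- The identity between the constants `g_j` (on the left) and `ζ_j` (on the right), both stripped of
their normalizations: the coefficient of each `a_{q-1}` is `binomial_difference`. -/
theorem sum_evenCoeff_eq_sum_oddCoeff (h : P = Q + 1) (m : ℕ) (a : ℕ → R) :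
    ∑ j ∈ Finset.Icc 1 (m + 1), (-1) ^ j * (-2 * a (j - 1) + ∑ l ∈ Finset.Icc 1 (m + 1 - j),
        (-1) ^ (l + 1) * ((2 * j + 2 * l).choose (2 * l) : R) * a (j + l - 1)) *
          (P ^ (2 * j) - Q ^ (2 * j)) =
      ∑ j ∈ Finset.range (m + 1), (-1) ^ j * (∑ l ∈ Finset.Icc 1 (m + 1 - j),
        (-1) ^ (l + 1) * ((2 * j + 2 * l).choose (2 * l - 1) : R) * a (j + l - 1)) *
          (P ^ (2 * j + 1) + Q ^ (2 * j + 1)) := by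
  simp_rw [mul_add _ (-2 * a _), add_mul _ _ (P ^ (2 * _) - Q ^ (2 * _)), Finset.sum_add_distrib,
    Finset.mul_sum, Finset.sum_mul]
  rw [sum_range_sum_Icc (M := R), sum_Icc_sum_Icc (M := R), ← Finset.sum_add_distrib]
  refine Finset.sum_congr rfl fun q hq => ?_
  obtain ⟨k, rfl⟩ : ∃ k, q = k + 1 := ⟨q - 1, by have := (Finset.mem_Icc.1 hq).1; omega⟩
  have key := binomial_difference h (k + 1)
  have hsplit : ∀ f : ℕ → R, ∑ j ∈ Finset.range (k + 1), f j =
      f 0 + ∑ j ∈ Finset.Ico 1 (k + 1), f j := fun f => by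
    rw [Finset.range_eq_Ico, Finset.sum_eq_sum_Ico_succ_bot (Nat.succ_pos k)]
  rw [Finset.sum_range_succ,
    hsplit fun j => ((2 * (k + 1)).choose (2 * j) : R) * (P ^ (2 * j) - Q ^ (2 * j))] at key
  simp only [mul_zero, pow_zero, sub_self, Nat.choose_self, Nat.cast_one,
    one_mul, zero_add] at key
  have e1 : ∑ j ∈ Finset.Ico 1 (k + 1), (-1) ^ j * ((-1) ^ (k + 1 - j + 1) *
      ((2 * j + 2 * (k + 1 - j)).choose (2 * (k + 1 - j)) : R) * a (j + (k + 1 - j) - 1)) *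
        (P ^ (2 * j) - Q ^ (2 * j)) =
      (-1) ^ k * a k * ∑ j ∈ Finset.Ico 1 (k + 1),
        ((2 * (k + 1)).choose (2 * j) : R) * (P ^ (2 * j) - Q ^ (2 * j)) := by
    rw [Finset.mul_sum]
    refine Finset.sum_congr rfl fun j hj => ?_
    obtain ⟨hj1, hj2⟩ := Finset.mem_Ico.1 hj
    have s1 : ((-1 : R)) ^ j * (-1) ^ (k + 1 - j + 1) = (-1) ^ k := by
      rw [← pow_add, show j + (k + 1 - j + 1) = k + 2 by omega, pow_add]
      ring
    have s2 : (2 * j + 2 * (k + 1 - j)).choose (2 * (k + 1 - j)) =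
        (2 * (k + 1)).choose (2 * j) := by
      rw [show 2 * j + 2 * (k + 1 - j) = 2 * (k + 1) by omega]
      exact Nat.choose_symm_of_eq_add (by omega)
    rw [s2, show j + (k + 1 - j) - 1 = k by omega, ← s1]
    ring
  have e2 : ∑ j ∈ Finset.range (k + 1), (-1) ^ j * ((-1) ^ (k + 1 - j + 1) *
      ((2 * j + 2 * (k + 1 - j)).choose (2 * (k + 1 - j) - 1) : R) * a (j + (k + 1 - j) - 1)) *
        (P ^ (2 * j + 1) + Q ^ (2 * j + 1)) =
      (-1) ^ k * a k * ∑ j ∈ Finset.range (k + 1),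
        ((2 * (k + 1)).choose (2 * j + 1) : R) * (P ^ (2 * j + 1) + Q ^ (2 * j + 1)) := by
    rw [Finset.mul_sum]
    refine Finset.sum_congr rfl fun j hj => ?_
    have hj2 := Finset.mem_range.1 hj
    have s1 : ((-1 : R)) ^ j * (-1) ^ (k + 1 - j + 1) = (-1) ^ k := by
      rw [← pow_add, show j + (k + 1 - j + 1) = k + 2 by omega, pow_add]
      ring
    have s2 : (2 * j + 2 * (k + 1 - j)).choose (2 * (k + 1 - j) - 1) =
        (2 * (k + 1)).choose (2 * j + 1) := by
      rw [show 2 * j + 2 * (k + 1 - j) = 2 * (k + 1) by omega]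
      exact Nat.choose_symm_of_eq_add (by omega)
    rw [s2, show j + (k + 1 - j) - 1 = k by omega, ← s1]
    ring
  rw [e1, e2, ← key, Nat.add_sub_cancel]
  ring

/-- The number `π^(N - 1/2) 2^N / π^(1/2)`, which all the products of the constants `μ_{2j-1}` and
`-ν_{2j+1}` with the corresponding normalized moments `c_{2j} / (2j)!` and `c_{2j+2} / (2j+1)!` of
bivectors are equal to. -/
def normConst (N : ℕ) : ℂ :=
  ((Real.pi ^ ((N : ℝ) - 1 / 2) * 2 ^ N / Real.pi ^ (1 / 2 : ℝ) : ℝ) : ℂ)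

theorem muC_mul_bivMoment (N j : ℕ) (hj : 1 ≤ j) : (muC N (2 * j - 1) : ℂ) *
    (((2 * j).factorial : ℂ)⁻¹ * bivMoment N (2 * j)) = normConst N := by
  have hpi : Real.pi ^ (1 / 2 : ℝ) ≠ 0 := by positivity
  have h1 : 2 * j - 1 + N - 1 = N + 2 * j - 2 := by omega
  have h2 : 2 * j - 1 + N + 1 = 2 * j + N := by omega
  have h3 : 2 * j - 1 + 1 = 2 * j := by omega
  have h : muC N (2 * j - 1) * (((2 * j).factorial : ℝ)⁻¹ *
      (((N + 2 * j - 2).factorial : ℝ) / 2 ^ (2 * j))) =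
      Real.pi ^ ((N : ℝ) - 1 / 2) * 2 ^ N / Real.pi ^ (1 / 2 : ℝ) := by
    have f1 : ((2 * j).factorial : ℝ) ≠ 0 := Nat.cast_ne_zero.2 (Nat.factorial_ne_zero _)
    have f2 : ((N + 2 * j - 2).factorial : ℝ) ≠ 0 := Nat.cast_ne_zero.2 (Nat.factorial_ne_zero _)
    rw [muC, omegaC, h1, h2, h3, pow_add]
    field_simp
  rw [normConst, ← h, bivMoment]
  push_cast
  rfl

theorem nuC_mul_bivMoment (N j : ℕ) : (nuC N (2 * j + 1) : ℂ) *
    (((2 * j + 1).factorial : ℂ)⁻¹ * bivMoment N (2 * j + 1 + 1)) = -normConst N := by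
  have h := muC_mul_bivMoment N (j + 1) (by omega)
  rw [show 2 * (j + 1) - 1 = 2 * j + 1 by omega, show 2 * (j + 1) = 2 * j + 1 + 1 by ring,
    Nat.factorial_succ] at h
  rw [← h, nuC]
  have f1 : ((2 * j + 1).factorial : ℂ) ≠ 0 := Nat.cast_ne_zero.2 (Nat.factorial_ne_zero _)
  have f2 : (2 * (j : ℂ) + 1 + 1) ≠ 0 := by exact_mod_cast (Nat.succ_ne_zero (2 * j + 1))
  push_cast
  field_simp

end Constants

/-! ### Invariance under rotations -/

section Invariance

variable {N : ℕ}

/-- The derivation of `ℂ[z, w]` by which a matrix acts on the variables. -/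
def rotDer (a : Matrix (Fin N) (Fin N) ℂ) : Derivation ℂ (PairPoly N) (PairPoly N) :=
  ∑ i, ∑ k, a i k • (zVar k • dz i + wVar k • dw i)

theorem rotDer_apply (a : Matrix (Fin N) (Fin N) ℂ) (f : PairPoly N) :
    rotDer a f = ∑ i, ∑ k, a i k • (zVar k * dz i f + wVar k * dw i f) := by
  rw [rotDer, ← Derivation.coeFnAddMonoidHom_apply, map_sum, Finset.sum_apply]
  refine Finset.sum_congr rfl fun i _ => ?_
  rw [map_sum, Finset.sum_apply]
  rfl

theorem rotDer_zVar (a : Matrix (Fin N) (Fin N) ℂ) (j : Fin N) :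
    rotDer a (zVar j) = ∑ k, a j k • zVar k := by
  rw [rotDer_apply, Finset.sum_eq_single j]
  · simp
  · intro i _ hi
    simp [hi]
  · simp

theorem rotDer_wVar (a : Matrix (Fin N) (Fin N) ℂ) (j : Fin N) :
    rotDer a (wVar j) = ∑ k, a j k • wVar k := by
  rw [rotDer_apply, Finset.sum_eq_single j]
  · simp
  · intro i _ hi
    simp [hi]
  · simp

theorem dz_dw_comm (k i : Fin N) (f : PairPoly N) : dz k (dw i f) = dw i (dz k f) := by
  have h : ⁅dz k, dw i⁆ = (0 : Derivation ℂ (PairPoly N) (PairPoly N)) := by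
    refine MvPolynomial.derivation_ext fun j => ?_
    rw [Derivation.commutator_apply]
    rcases j with j | j
    · have h1 := dz_zVar (N := N) k j
      have h2 := dw_zVar (N := N) i j
      rw [zVar] at h1 h2
      rw [h1, h2]
      split_ifs <;> simp
    · have h1 := dz_wVar (N := N) k j
      have h2 := dw_wVar (N := N) i j
      rw [wVar] at h1 h2
      rw [h1, h2]
      split_ifs <;> simp
  have h' := congrArg (fun D => D f) h
  rwa [Derivation.commutator_apply, Derivation.zero_apply, sub_eq_zero] at h'

/-- The Gaussian functional is invariant under the complex orthogonal group, acting
simultaneously on `z` and `w`. -/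
theorem gauss_rotDer {a : Matrix (Fin N) (Fin N) ℂ} (ha : aᵀ = -a) (f : PairPoly N) :
    gauss N (rotDer a f) = 0 := by
  have hskew : ∀ i k, a k i = -a i k := fun i k => congrFun (congrFun ha i) k
  have hcomm : ∀ i k, dz k (dw i f) = dw i (dz k f) := fun i k => dz_dw_comm k i f
  have h : gauss N (rotDer a f) = ∑ i, ∑ k, a i k * gauss N (dw k (dz i f)) +
      ∑ i, ∑ k, a i k * gauss N (dw i (dz k f)) := by
    rw [rotDer_apply, map_sum, ← Finset.sum_add_distrib]
    refine Finset.sum_congr rfl fun i _ => ?_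
    rw [map_sum, ← Finset.sum_add_distrib]
    refine Finset.sum_congr rfl fun k _ => ?_
    rw [map_smul, map_add, gauss_zVar_mul, gauss_wVar_mul, hcomm, smul_eq_mul, mul_add]
  rw [h, Finset.sum_comm (f := fun i k => a i k * gauss N (dw i (dz k f))),
    ← Finset.sum_add_distrib]
  refine Finset.sum_eq_zero fun i _ => ?_
  rw [← Finset.sum_add_distrib]
  exact Finset.sum_eq_zero fun k _ => by rw [hskew i k]; ring

theorem gaussExt_rotDer {A : Type*} [Ring A] [Algebra ℂ A] {a : Matrix (Fin N) (Fin N) ℂ}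
    (ha : aᵀ = -a) (t : PairPoly N ⊗[ℂ] A) : gaussExt N A (derExt A (rotDer a) t) = 0 := by
  induction t with
  | zero => simp
  | add x y hx hy => rw [map_add, map_add, hx, hy, add_zero]
  | tmul p b => rw [derExt_tmul, gaussExt_tmul, gauss_rotDer ha, zero_smul]

theorem soN_transpose (a : soN N) :
    (a : Matrix (Fin N) (Fin N) ℂ)ᵀ = -(a : Matrix (Fin N) (Fin N) ℂ) :=
  (LieAlgebra.Orthogonal.mem_so _ _ _).1 a.2

attribute [local instance] LieRing.ofAssociativeRing

/-- In matrix form, `[a, z wᵀ] = (a z) wᵀ + z (a w)ᵀ`. -/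
theorem lie_coord (a : soN N) (i j : Fin N) : ⁅a, coord N i j⁆ =
    ∑ k, ((a : Matrix (Fin N) (Fin N) ℂ) k j • coord N i k +
      (a : Matrix (Fin N) (Fin N) ℂ) k i • coord N k j) := by
  have hskew : ∀ i k, (a : Matrix (Fin N) (Fin N) ℂ) i k =
      -(a : Matrix (Fin N) (Fin N) ℂ) k i :=
    fun i k => congrFun (congrFun (soN_transpose a) k) i
  apply Subtype.ext
  rw [LieSubalgebra.coe_bracket, Ring.lie_def, AddSubmonoidClass.coe_finsetSum]
  ext p q
  rw [Matrix.sub_apply, Matrix.sum_apply, coord]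
  simp only [Matrix.mul_smul, Matrix.smul_mul, Matrix.smul_apply, Matrix.mul_sub, Matrix.sub_mul,
    Matrix.sub_apply, AddMemClass.coe_add, SetLike.val_smul, coord, Matrix.add_apply,
    smul_eq_mul]
  simp only [Matrix.mul_apply, Matrix.single_apply]
  simp only [mul_ite, ite_mul, mul_one, mul_zero, one_mul, zero_mul, ite_and,
    Finset.sum_add_distrib, mul_sub, Finset.sum_sub_distrib, Finset.sum_ite_eq,
    Finset.sum_ite_eq', Finset.mem_univ, if_true]
  split_ifs <;> simp [hskew j q, hskew i q] <;> ring

/-- The adjoint action of `𝔰𝔬_N` on the universal form is the action on the variables. -/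
theorem ι_mul_pairForm_sub (a : soN N) :
    ((1 : PairPoly N) ⊗ₜ[ℂ] UniversalEnvelopingAlgebra.ι ℂ a) * pairForm (envMatrix N) -
        pairForm (envMatrix N) * ((1 : PairPoly N) ⊗ₜ[ℂ] UniversalEnvelopingAlgebra.ι ℂ a) =
      derExt _ (rotDer (a : Matrix (Fin N) (Fin N) ℂ)) (pairForm (envMatrix N)) := by
  have h1 : ((1 : PairPoly N) ⊗ₜ[ℂ] UniversalEnvelopingAlgebra.ι ℂ a) * pairForm (envMatrix N) -
        pairForm (envMatrix N) * ((1 : PairPoly N) ⊗ₜ[ℂ] UniversalEnvelopingAlgebra.ι ℂ a) =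
      ∑ i, ∑ j, ∑ k, ((wVar i * zVar j) ⊗ₜ[ℂ]
          ((a : Matrix (Fin N) (Fin N) ℂ) k j • envMatrix N i k) +
        (wVar i * zVar j) ⊗ₜ[ℂ] ((a : Matrix (Fin N) (Fin N) ℂ) k i • envMatrix N k j)) := by
    rw [pairForm, Finset.mul_sum, Finset.sum_mul, ← Finset.sum_sub_distrib]
    refine Finset.sum_congr rfl fun i _ => ?_
    rw [Finset.mul_sum, Finset.sum_mul, ← Finset.sum_sub_distrib]
    refine Finset.sum_congr rfl fun j _ => ?_
    rw [Algebra.TensorProduct.tmul_mul_tmul, Algebra.TensorProduct.tmul_mul_tmul, one_mul, mul_one,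
      ← TensorProduct.tmul_sub, envMatrix, Matrix.of_apply, ← Ring.lie_def, ← LieHom.map_lie,
      lie_coord, map_sum, TensorProduct.tmul_sum]
    refine Finset.sum_congr rfl fun k _ => ?_
    rw [map_add, map_smul, map_smul, TensorProduct.tmul_add]
    rfl
  have h2 : derExt _ (rotDer (a : Matrix (Fin N) (Fin N) ℂ)) (pairForm (envMatrix N)) =
      ∑ i, ∑ j, ∑ k, ((wVar i * ((a : Matrix (Fin N) (Fin N) ℂ) j k • zVar k)) ⊗ₜ[ℂ]
          envMatrix N i j +
        (((a : Matrix (Fin N) (Fin N) ℂ) i k • wVar k) * zVar j) ⊗ₜ[ℂ] envMatrix N i j) := by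
    rw [pairForm, map_sum]
    refine Finset.sum_congr rfl fun i _ => ?_
    rw [map_sum]
    refine Finset.sum_congr rfl fun j _ => ?_
    rw [derExt_tmul, Derivation.leibniz, rotDer_zVar, rotDer_wVar, smul_eq_mul, smul_eq_mul,
      mul_comm (zVar j), Finset.mul_sum, Finset.sum_mul, ← Finset.sum_add_distrib,
      TensorProduct.sum_tmul]
    exact Finset.sum_congr rfl fun k _ => TensorProduct.add_tmul _ _ _
  rw [h1, h2]
  simp_rw [Finset.sum_add_distrib]
  refine congrArg₂ (· + ·) ?_ ?_
  · refine Finset.sum_congr rfl fun i _ => ?_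
    rw [Finset.sum_comm]
    refine Finset.sum_congr rfl fun k _ => Finset.sum_congr rfl fun j _ => ?_
    rw [TensorProduct.tmul_smul, TensorProduct.smul_tmul', mul_smul_comm]
  · rw [Finset.sum_comm]
    conv_rhs => rw [Finset.sum_comm]
    refine Finset.sum_congr rfl fun j _ => ?_
    rw [Finset.sum_comm]
    refine Finset.sum_congr rfl fun k _ => Finset.sum_congr rfl fun i _ => ?_
    rw [TensorProduct.tmul_smul, TensorProduct.smul_tmul', smul_mul_assoc]

theorem commutator_mul {T : Type*} [Ring T] (b s t : T) :
    b * (s * t) - s * t * b = (b * s - s * b) * t + s * (b * t - t * b) := by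
  noncomm_ring

theorem commute_ι_gaussExt_pow (a : soN N) (n : ℕ) :
    Commute (UniversalEnvelopingAlgebra.ι ℂ a) (gaussExt N _ (pairForm (envMatrix N) ^ n)) := by
  have h : ∀ n : ℕ, ((1 : PairPoly N) ⊗ₜ[ℂ] UniversalEnvelopingAlgebra.ι ℂ a) *
        pairForm (envMatrix N) ^ n -
      pairForm (envMatrix N) ^ n * ((1 : PairPoly N) ⊗ₜ[ℂ] UniversalEnvelopingAlgebra.ι ℂ a) =
      derExt _ (rotDer (a : Matrix (Fin N) (Fin N) ℂ)) (pairForm (envMatrix N) ^ n) := by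
    intro n
    induction n with
    | zero =>
      rw [pow_zero, one_mul, mul_one, sub_self, Algebra.TensorProduct.one_def, derExt_tmul]
      simp
    | succ n ih =>
      rw [pow_succ, derExt_mul, ← ih, ← ι_mul_pairForm_sub]
      exact commutator_mul _ _ _
  have h2 := congrArg (gaussExt N _) (h n)
  rw [gaussExt_rotDer (soN_transpose a), map_sub, gaussExt_one_tmul_mul, gaussExt_mul_one_tmul,
    sub_eq_zero] at h2
  exact h2

theorem commute_ι_casimirC (m : ℕ) (ζ : ℕ → ℂ) (a : soN N) :
    Commute (UniversalEnvelopingAlgebra.ι ℂ a) (casimirC N m ζ) := by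
  rw [casimirC_eq]
  exact Commute.sum_right _ _ _ fun j _ => (commute_ι_gaussExt_pow a _).smul_right _

theorem casimirC_mem_center (m : ℕ) (ζ : ℕ → ℂ) :
    casimirC N m ζ ∈ Subalgebra.center ℂ (UniversalEnvelopingAlgebra ℂ (soN N)) := by
  rw [Subalgebra.mem_center_iff]
  intro b
  obtain ⟨t, rfl⟩ : ∃ t, UniversalEnvelopingAlgebra.mkAlgHom ℂ (soN N) t = b :=
    RingCon.mkₐ_surjective _ b
  change Commute _ _
  induction t using TensorAlgebra.induction with
  | algebraMap r => rw [AlgHom.commutes]; exact Algebra.commutes r _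
  | ι a => exact commute_ι_casimirC m ζ a
  | mul s t hs ht => rw [map_mul]; exact hs.mul_left ht
  | add s t hs ht => rw [map_add]; exact hs.add_left ht

end Invariance

/-! ### The central element of the Hecke algebra -/

section HeckeRelations

variable {N : ℕ}

theorem map_gaussExt {A B : Type*} [Ring A] [Algebra ℂ A] [Ring B] [Algebra ℂ B] (f : A →ₐ[ℂ] B)
    (p : PairPoly N) (a : Matrix (Fin N) (Fin N) A) (n : ℕ) :
    f (gaussExt N A (p • pairForm a ^ n)) = gaussExt N B (p • pairForm (a.map f) ^ n) := by
  rw [pairForm_eq_sum_prod, pairForm_eq_sum_prod,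
    gaussExt_smul_pow p (fun e : Fin N × Fin N => wVar e.1 * zVar e.2),
    gaussExt_smul_pow p (fun e : Fin N × Fin N => wVar e.1 * zVar e.2), map_sum]
  refine Finset.sum_congr rfl fun g _ => ?_
  rw [map_smul, map_list_prod, List.map_ofFn]
  rfl

/-- The defining relations of the Hecke algebra, for the images `f` of `U(𝔰𝔬_N)` and `v` of `V_N` in
an algebra. -/
structure IsHeckePair {A : Type*} [Ring A] [Algebra ℂ A] (m : ℕ) (ζ : ℕ → ℂ)
    (f : UniversalEnvelopingAlgebra ℂ (soN N) →ₐ[ℂ] A) (v : VN N →ₗ[ℂ] A) : Prop where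
  act : ∀ (a : soN N) (x : VN N),
    f (UniversalEnvelopingAlgebra.ι ℂ a) * v x - v x * f (UniversalEnvelopingAlgebra.ι ℂ a) =
      v ((a : Matrix (Fin N) (Fin N) ℂ) *ᵥ x)
  comm : ∀ x y : VN N, v x * v y - v y * v x = f (kappa N m ζ x y)

variable {A : Type*} [Ring A] [Algebra ℂ A]

/-- The image of the basis vector `xₖ` of `V_N`. -/
def basisVec (v : VN N →ₗ[ℂ] A) (k : Fin N) : A := v (Pi.single k 1)

/-- The image of the matrix of generators `(E_{ji} - E_{ij}) / 2` of `𝔰𝔬_N`. -/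
def rotMatrix (f : UniversalEnvelopingAlgebra ℂ (soN N) →ₐ[ℂ] A) : Matrix (Fin N) (Fin N) A :=
  (envMatrix N).map f

/-- The image of `t₁ = ∑ xₖ²`. -/
def sqNorm (v : VN N →ₗ[ℂ] A) : A := ∑ k, basisVec v k ^ 2

theorem map_eq_sum_basis (v : VN N →ₗ[ℂ] A) (y : VN N) : v y = ∑ k, y k • basisVec v k := by
  conv_lhs => rw [← Finset.univ_sum_single y]
  rw [map_sum]
  refine Finset.sum_congr rfl fun k _ => ?_
  rw [basisVec, ← map_smul, ← Pi.single_smul, smul_eq_mul, mul_one]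

variable {m : ℕ} {ζ : ℕ → ℂ} {f : UniversalEnvelopingAlgebra ℂ (soN N) →ₐ[ℂ] A}
  {v : VN N →ₗ[ℂ] A}

/-- `coord N i j = (E_{ji} - E_{ij}) / 2`, so it maps `xᵢ` to `½ xⱼ` and `xⱼ` to `-½ xᵢ`. -/
theorem IsHeckePair.isRotationPair (h : IsHeckePair m ζ f v) : IsRotationPair (rotMatrix f) (basisVec v) where
  skew i j := by
    rw [rotMatrix, Matrix.map_apply, Matrix.map_apply, envMatrix, Matrix.of_apply,
      Matrix.of_apply, coord_swap, map_neg, map_neg]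
  comm i j k := by
    rw [rotMatrix, Matrix.map_apply, envMatrix, Matrix.of_apply, basisVec,
      h.act]
    have h1 : (coord N i j : Matrix (Fin N) (Fin N) ℂ) *ᵥ Pi.single k 1 = (1 / 2 : ℂ) •
        ((if i = k then Pi.single j 1 else 0) - if j = k then Pi.single i 1 else 0) := by
      ext p
      rw [Matrix.mulVec_single_one, coord]
      simp only [Matrix.col_apply, Matrix.smul_apply, Matrix.sub_apply, Matrix.single_apply,
        Pi.smul_apply, Pi.sub_apply]
      congr 2
      · by_cases h1 : i = k <;> by_cases h2 : j = p <;> simp [h1, h2, eq_comm]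
      · by_cases h1 : j = k <;> by_cases h2 : i = p <;> simp [h1, h2, eq_comm]
    rw [h1, map_smul, map_sub, apply_ite (v), apply_ite (v), map_zero]
    rfl

theorem vecForm_constVec (y : VN N) : vecForm (basisVec v) (constVec y) =
    (1 : PairPoly N) ⊗ₜ[ℂ] v y := by
  rw [vecForm, map_eq_sum_basis, TensorProduct.tmul_sum]
  refine Finset.sum_congr rfl fun k _ => ?_
  rw [constVec, MvPolynomial.C_eq_smul_one, TensorProduct.tmul_smul, TensorProduct.smul_tmul']

/-- Summed against the basis, the weights `(w, y)(z, xₖ) - (w, xₖ)(z, y)` give twice the vector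
obtained by applying the bivector `z ∧ w` to `y`. -/
theorem wedgeForm_single (y : VN N) (k : Fin N) :
    wedgeForm (Pi.single k 1) y = (2 : ℂ) • bivAct (constVec y) k := by
  have h1 : ∀ v : Fin N → PairPoly N, ∑ i, (Pi.single k (1 : ℂ) : Fin N → ℂ) i • v i = v k := by
    intro v
    rw [Finset.sum_eq_single k]
    · simp
    · intro i _ hi
      simp [hi]
    · simp
  have h2 : ∀ v : Fin N → PairPoly N, ∑ i, y i • v i = ∑ i, v i * constVec y i := by
    intro v
    refine Finset.sum_congr rfl fun i _ => ?_
    rw [constVec, MvPolynomial.smul_eq_C_mul, mul_comm]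
  rw [wedgeForm, h1, h1, h2, h2, bivAct, smul_smul, wDot, zDot, mul_comm (wVar k)]
  norm_num

theorem sum_wedgeForm_tmul (y : VN N) :
    ∑ k, wedgeForm (Pi.single k 1) y ⊗ₜ[ℂ] basisVec v k =
      (2 : ℂ) • vecForm (basisVec v) (bivAct (constVec y)) := by
  rw [vecForm, Finset.smul_sum]
  refine Finset.sum_congr rfl fun k _ => ?_
  rw [wedgeForm_single, TensorProduct.smul_tmul']

/-- The linear functional on polynomials through which all the commutators with `y` factor. -/
def heckeUmbral (f : UniversalEnvelopingAlgebra ℂ (soN N) →ₐ[ℂ] A) (v : VN N →ₗ[ℂ] A) (y : VN N) :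
    Polynomial ℂ →ₗ[ℂ] A :=
  umbral (bivMoment N) (gaussExt N A) (pairForm (rotMatrix f))
    (vecForm (basisVec v) (bivAct (constVec y)))

theorem map_rOdd (j : ℕ) (x y : VN N) : f (rOdd N j x y) =
    ((1 / 2 : ℂ) * (-1) ^ j * ((2 * j + 1).factorial : ℂ)⁻¹) •
      gaussExt N _ (wedgeForm x y • pairForm (rotMatrix f) ^ (2 * j + 1)) := by
  rw [rOdd_eq, map_smul, map_gaussExt]
  rfl

/-- The contribution of `r_{2j+1}` to the commutator of `t₁` with `y`. -/
theorem IsHeckePair.sum_basisVec_mul_rOdd (h : IsHeckePair m ζ f v) (hN : 1 ≤ N) (j : ℕ) (y : VN N) :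
    ∑ k, (basisVec v k * f (rOdd N j (Pi.single k 1) y) +
        f (rOdd N j (Pi.single k 1) y) * basisVec v k) =
      ((-1) ^ j * (((2 * j + 1).factorial : ℂ)⁻¹ * bivMoment N (2 * j + 1 + 1))) •
        heckeUmbral f v y ((Polynomial.X + Polynomial.C (1 / 2)) ^ (2 * j + 1) +
          (Polynomial.X + Polynomial.C (-1 / 2)) ^ (2 * j + 1)) := by
  set X := pairForm (rotMatrix f) with hX
  have h1 : ∑ k, (basisVec v k * gaussExt N _ (wedgeForm (Pi.single k 1) y • X ^ (2 * j + 1)) +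
      gaussExt N _ (wedgeForm (Pi.single k 1) y • X ^ (2 * j + 1)) * basisVec v k) =
      (2 : ℂ) • gaussExt N _ (X ^ (2 * j + 1) * vecForm (basisVec v) (bivAct (constVec y)) +
        vecForm (basisVec v) (bivAct (constVec y)) * X ^ (2 * j + 1)) := by
    rw [← map_smul, smul_add, ← smul_mul_assoc (2 : ℂ) (vecForm _ _), ← mul_smul_comm (2 : ℂ), ← sum_wedgeForm_tmul,
      Finset.sum_mul, Finset.mul_sum, ← Finset.sum_add_distrib, map_sum]
    refine Finset.sum_congr rfl fun k _ => ?_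
    have e : wedgeForm (Pi.single k 1) y ⊗ₜ[ℂ] basisVec v k =
        wedgeForm (Pi.single k 1) y • ((1 : PairPoly N) ⊗ₜ[ℂ] basisVec v k) := by
      rw [TensorProduct.smul_tmul', smul_eq_mul, mul_one]
    rw [← gaussExt_one_tmul_mul, ← gaussExt_mul_one_tmul, e, mul_smul_comm, smul_mul_assoc,
      mul_smul_comm, smul_mul_assoc, map_add, add_comm]
  have h2 := map_pow_mul_add (c := bivMoment N) (E := gaussExt N A)
    (gaussExt_symOp_altOp hN h.isRotationPair y) (2 * j + 1)
  rw [← hX] at h2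
  rw [h2, smul_smul] at h1
  simp_rw [map_rOdd, mul_smul_comm, smul_mul_assoc, ← smul_add]
  rw [← Finset.smul_sum, ← hX, h1, smul_smul, heckeUmbral]
  congr 1
  ring

theorem IsHeckePair.sqNorm_mul_sub (h : IsHeckePair m ζ f v) (y : VN N) : sqNorm v * v y - v y * sqNorm v =
    ∑ j ∈ Finset.range (m + 1), ζ j •
      ∑ k, (basisVec v k * f (rOdd N j (Pi.single k 1) y) +
        f (rOdd N j (Pi.single k 1) y) * basisVec v k) := by
  simp_rw [Finset.smul_sum]
  rw [Finset.sum_comm, sqNorm, Finset.sum_mul, Finset.mul_sum, ← Finset.sum_sub_distrib]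
  refine Finset.sum_congr rfl fun k _ => ?_
  have h2 : ∀ x b : A, x ^ 2 * b - b * x ^ 2 =
      x * (x * b - b * x) + (x * b - b * x) * x := fun x b => by noncomm_ring
  rw [h2, basisVec, h.comm, kappa, map_sum, Finset.mul_sum, Finset.sum_mul, ← Finset.sum_add_distrib]
  refine Finset.sum_congr rfl fun j _ => ?_
  rw [map_smul, mul_smul_comm, smul_mul_assoc, smul_add]

/-- The commutator of `C` with `y`. -/
theorem IsHeckePair.casimirC_mul_sub (h : IsHeckePair m ζ f v) (hN : 1 ≤ N) (y : VN N) :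
    f (casimirC N m ζ) * v y -
        v y * f (casimirC N m ζ) =
      ∑ j ∈ Finset.Icc 1 (m + 1),
        (gCoeff N m ζ j * ((-1) ^ j * (((2 * j).factorial : ℂ)⁻¹ * bivMoment N (2 * j)))) •
          heckeUmbral f v y ((Polynomial.X + Polynomial.C (1 / 2)) ^ (2 * j) -
            (Polynomial.X + Polynomial.C (-1 / 2)) ^ (2 * j)) := by
  have hU : ∀ n : ℕ, f (gaussExt N _ (pairForm (envMatrix N) ^ n)) =
      gaussExt N _ (pairForm (rotMatrix f) ^ n) := by
    intro n
    have h := map_gaussExt f (1 : PairPoly N) (envMatrix N) n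
    rwa [one_smul, one_smul] at h
  have hu : pairForm (rotMatrix f) * ((1 : PairPoly N) ⊗ₜ[ℂ] v y) -
      ((1 : PairPoly N) ⊗ₜ[ℂ] v y) * pairForm (rotMatrix f) =
      vecForm (basisVec v) (bivAct (constVec y)) := by
    rw [← vecForm_constVec, h.isRotationPair.pairForm_mul_vecForm_sub]
  rw [casimirC_eq, map_sum, Finset.sum_mul, Finset.mul_sum, ← Finset.sum_sub_distrib]
  refine Finset.sum_congr rfl fun j _ => ?_
  have h2 := map_pow_mul_sub (c := bivMoment N) (E := gaussExt N A) hu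
    (gaussExt_symOp_altOp hN h.isRotationPair y) (2 * j)
  rw [map_sub (gaussExt N A), gaussExt_one_tmul_mul, gaussExt_mul_one_tmul] at h2
  rw [map_smul, hU, smul_mul_assoc, mul_smul_comm, ← smul_sub, h2, smul_smul, heckeUmbral]
  congr 1
  ring

/-- The commutators of `t₁` and `C` with `y` cancel: both are images, under the same linear functional,
of polynomials that agree up to sign by `sum_evenCoeff_eq_sum_oddCoeff`. -/
theorem IsHeckePair.commute_vec (h : IsHeckePair m ζ f v) (hN : 1 ≤ N) (y : VN N) :
    Commute (v y) (sqNorm v + f (casimirC N m ζ)) := by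
  set P : Polynomial ℂ := Polynomial.X + Polynomial.C (1 / 2) with hP
  set Q : Polynomial ℂ := Polynomial.X + Polynomial.C (-1 / 2) with hQ
  have hPQ : P = Q + 1 := by
    rw [hP, hQ, ← Polynomial.C_1, add_assoc, ← map_add]
    norm_num
  have h1 : sqNorm v * v y - v y * sqNorm v =
      heckeUmbral f v y ((-2 * normConst N) • ∑ j ∈ Finset.range (m + 1),
        (-1) ^ j * (∑ l ∈ Finset.Icc 1 (m + 1 - j), (-1) ^ (l + 1) *
          ((2 * j + 2 * l).choose (2 * l - 1) : Polynomial ℂ) *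
            Polynomial.C (aSeq N m ζ (j + l - 1))) * (P ^ (2 * j + 1) + Q ^ (2 * j + 1))) := by
    rw [h.sqNorm_mul_sub, Finset.smul_sum, map_sum]
    refine Finset.sum_congr rfl fun j hj => ?_
    have hjm : j ≤ m := Nat.lt_succ_iff.1 (Finset.mem_range.1 hj)
    rw [h.sum_basisVec_mul_rOdd hN, smul_smul, ← map_smul, ← hP, ← hQ]
    congr 1
    have hc : (∑ l ∈ Finset.Icc 1 (m + 1 - j), (-1) ^ (l + 1) *
          ((2 * j + 2 * l).choose (2 * l - 1) : Polynomial ℂ) *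
            Polynomial.C (aSeq N m ζ (j + l - 1))) =
        Polynomial.C (∑ l ∈ Finset.Icc 1 (m + 1 - j), (-1) ^ (l + 1) *
          ((2 * j + 2 * l).choose (2 * l - 1) : ℂ) * aSeq N m ζ (j + l - 1)) := by
      simp
    have hn : (-1 : Polynomial ℂ) ^ j = Polynomial.C ((-1) ^ j) := by simp
    rw [hc, hn, ← map_mul, ← Polynomial.smul_eq_C_mul, smul_smul]
    congr 1
    rw [aSeq_recursion N m ζ j hjm]
    linear_combination (2 * (-1) ^ j * ∑ l ∈ Finset.Icc 1 (m + 1 - j), (-1) ^ (l + 1) *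
          ((2 * j + 2 * l).choose (2 * l - 1) : ℂ) * aSeq N m ζ (j + l - 1)) *
            nuC_mul_bivMoment N j
  have h2 : f (casimirC N m ζ) * v y -
        v y * f (casimirC N m ζ) =
      heckeUmbral f v y ((2 * normConst N) • ∑ j ∈ Finset.Icc 1 (m + 1),
        (-1) ^ j * (-2 * Polynomial.C (aSeq N m ζ (j - 1)) +
          ∑ l ∈ Finset.Icc 1 (m + 1 - j), (-1) ^ (l + 1) *
            ((2 * j + 2 * l).choose (2 * l) : Polynomial ℂ) *
              Polynomial.C (aSeq N m ζ (j + l - 1))) * (P ^ (2 * j) - Q ^ (2 * j))) := by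
    rw [h.casimirC_mul_sub hN, Finset.smul_sum, map_sum]
    refine Finset.sum_congr rfl fun j hj => ?_
    have hj1 : 1 ≤ j := (Finset.mem_Icc.1 hj).1
    rw [← map_smul, ← hP, ← hQ]
    congr 1
    have hc : (-2 * Polynomial.C (aSeq N m ζ (j - 1)) +
          ∑ l ∈ Finset.Icc 1 (m + 1 - j), (-1) ^ (l + 1) *
            ((2 * j + 2 * l).choose (2 * l) : Polynomial ℂ) *
              Polynomial.C (aSeq N m ζ (j + l - 1))) =
        Polynomial.C (-2 * aSeq N m ζ (j - 1) + ∑ l ∈ Finset.Icc 1 (m + 1 - j), (-1) ^ (l + 1) *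
          ((2 * j + 2 * l).choose (2 * l) : ℂ) * aSeq N m ζ (j + l - 1)) := by
      have h2 : Polynomial.C (2 : ℂ) = 2 := map_ofNat _ 2
      simp [h2]
    have hn : (-1 : Polynomial ℂ) ^ j = Polynomial.C ((-1) ^ j) := by simp
    rw [hc, hn, ← map_mul, ← Polynomial.smul_eq_C_mul, smul_smul]
    congr 1
    rw [gCoeff]
    linear_combination (2 * (-1) ^ j * (-2 * aSeq N m ζ (j - 1) +
      ∑ l ∈ Finset.Icc 1 (m + 1 - j), (-1) ^ (l + 1) *
          ((2 * j + 2 * l).choose (2 * l) : ℂ) * aSeq N m ζ (j + l - 1))) *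
            muC_mul_bivMoment N j hj1
  rw [sum_evenCoeff_eq_sum_oddCoeff hPQ m fun j => Polynomial.C (aSeq N m ζ j)] at h2
  have h3 := congrArg₂ (· + ·) h1 h2
  simp only [← map_add, ← add_smul] at h3
  rw [show -2 * normConst N + 2 * normConst N = 0 by ring, zero_smul, map_zero] at h3
  refine (sub_eq_zero.1 (Eq.trans ?_ h3)).symm
  rw [add_mul, mul_add]
  abel

theorem IsHeckePair.commute_lie (h : IsHeckePair m ζ f v) (a : soN N) :
    Commute (f (UniversalEnvelopingAlgebra.ι ℂ a))
      (sqNorm v + f (casimirC N m ζ)) := by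
  refine Commute.add_right ?_ ((commute_ι_casimirC m ζ a).map f)
  have hskew : ∀ i k, (a : Matrix (Fin N) (Fin N) ℂ) k i =
      -(a : Matrix (Fin N) (Fin N) ℂ) i k :=
    fun i k => congrFun (congrFun (soN_transpose a) i) k
  have hb : ∀ k, f (UniversalEnvelopingAlgebra.ι ℂ a) * basisVec v k -
      basisVec v k * f (UniversalEnvelopingAlgebra.ι ℂ a) =
      ∑ i, (a : Matrix (Fin N) (Fin N) ℂ) i k • basisVec v i := by
    intro k
    rw [basisVec, h.act, map_eq_sum_basis v, Matrix.mulVec_single_one]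
    rfl
  have h1 : ∀ g x : A, g * x ^ 2 - x ^ 2 * g =
      (g * x - x * g) * x + x * (g * x - x * g) := fun x b => by noncomm_ring
  have h2 : f (UniversalEnvelopingAlgebra.ι ℂ a) * sqNorm v -
      sqNorm v * f (UniversalEnvelopingAlgebra.ι ℂ a) =
      ∑ k, ∑ i, (a : Matrix (Fin N) (Fin N) ℂ) i k • (basisVec v i * basisVec v k) +
      ∑ k, ∑ i, (a : Matrix (Fin N) (Fin N) ℂ) i k • (basisVec v k * basisVec v i) := by
    rw [sqNorm, Finset.mul_sum, Finset.sum_mul, ← Finset.sum_sub_distrib, ← Finset.sum_add_distrib]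
    refine Finset.sum_congr rfl fun k _ => ?_
    rw [h1, hb k, Finset.sum_mul, Finset.mul_sum]
    refine congrArg₂ (· + ·) (Finset.sum_congr rfl fun i _ => ?_)
      (Finset.sum_congr rfl fun i _ => ?_)
    · rw [smul_mul_assoc]
    · rw [mul_smul_comm]
  refine sub_eq_zero.1 (h2.trans ?_)
  rw [Finset.sum_comm, ← Finset.sum_add_distrib]
  refine Finset.sum_eq_zero fun i _ => ?_
  rw [← Finset.sum_add_distrib]
  refine Finset.sum_eq_zero fun k _ => ?_
  rw [hskew i k, ← add_smul, add_neg_cancel, zero_smul]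

end HeckeRelations

section HeckeAlgebra

variable {N : ℕ}

variable (m : ℕ) (ζ : ℕ → ℂ)

theorem heckeU_ι (a : soN N) : heckeU N m ζ (UniversalEnvelopingAlgebra.ι ℂ a) =
    RingQuot.mkAlgHom ℂ (HeckeRel N m ζ)
      (RingQuot.mkAlgHom ℂ (SmashRel N) (TensorAlgebra.ι ℂ (a, 0))) := by
  rw [heckeU, AlgHom.comp_apply, smashU, UniversalEnvelopingAlgebra.lift_ι_apply]
  rfl

theorem heckeVec_apply (x : VN N) : heckeVec N m ζ x =
    RingQuot.mkAlgHom ℂ (HeckeRel N m ζ)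
      (RingQuot.mkAlgHom ℂ (SmashRel N) (TensorAlgebra.ι ℂ (0, x))) := rfl

theorem heckeU_ι_mul_heckeVec_sub (a : soN N) (x : VN N) :
    heckeU N m ζ (UniversalEnvelopingAlgebra.ι ℂ a) * heckeVec N m ζ x -
      heckeVec N m ζ x * heckeU N m ζ (UniversalEnvelopingAlgebra.ι ℂ a) =
      heckeVec N m ζ ((a : Matrix (Fin N) (Fin N) ℂ) *ᵥ x) := by
  have h := congrArg (RingQuot.mkAlgHom ℂ (HeckeRel N m ζ))
    (RingQuot.mkAlgHom_rel ℂ (SmashRel.act a x))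
  rw [map_sub, map_sub, map_mul, map_mul, map_mul, map_mul] at h
  rw [heckeU_ι, heckeVec_apply, heckeVec_apply, h]

theorem heckeVec_comm (x y : VN N) :
    heckeVec N m ζ x * heckeVec N m ζ y - heckeVec N m ζ y * heckeVec N m ζ x =
      heckeU N m ζ (kappa N m ζ x y) := by
  have h := RingQuot.mkAlgHom_rel ℂ (HeckeRel.comm (m := m) (ζ := ζ) x y)
  rw [map_sub, map_mul, map_mul] at h
  exact h

theorem isHeckePair_hecke : IsHeckePair (A := HeckeAlg N m ζ) m ζ (heckeU N m ζ) (heckeVec N m ζ) where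
  act := heckeU_ι_mul_heckeVec_sub m ζ
  comm := heckeVec_comm m ζ

theorem tOne_add_casimirC_mem_center (hN : 1 ≤ N) :
    tOne N m ζ + heckeU N m ζ (casimirC N m ζ) ∈ Subalgebra.center ℂ (HeckeAlg N m ζ) := by
  rw [Subalgebra.mem_center_iff]
  intro b
  obtain ⟨s, rfl⟩ := RingQuot.mkAlgHom_surjective ℂ (HeckeRel N m ζ) b
  obtain ⟨t, rfl⟩ := RingQuot.mkAlgHom_surjective ℂ (SmashRel N) s
  change Commute _ _
  induction t using TensorAlgebra.induction with
  | algebraMap r => rw [AlgHom.commutes, AlgHom.commutes]; exact Algebra.commutes r _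
  | ι a =>
    rw [← Prod.fst_add_snd a, map_add, map_add, map_add]
    exact Commute.add_left (heckeU_ι m ζ a.1 ▸ (isHeckePair_hecke m ζ).commute_lie a.1)
      ((isHeckePair_hecke m ζ).commute_vec hN a.2)
  | mul s t hs ht => rw [map_mul, map_mul]; exact hs.mul_left ht
  | add s t hs ht => rw [map_add, map_add]; exact hs.add_left ht

end HeckeAlgebra

end SoHecke

end

theorem theorem6p1 (N : ℕ) (hN : 3 ≤ N) (m : ℕ) (ζ : ℕ → ℂ) :
    SoHecke.casimirC N m ζ ∈
        Subalgebra.center ℂ (UniversalEnvelopingAlgebra ℂ (SoHecke.soN N)) ∧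
      SoHecke.tOne N m ζ + SoHecke.heckeU N m ζ (SoHecke.casimirC N m ζ) ∈
        Subalgebra.center ℂ (SoHecke.HeckeAlg N m ζ) :=
  ⟨SoHecke.casimirC_mem_center m ζ,
    SoHecke.tOne_add_casimirC_mem_center m ζ (le_trans (by norm_num) hN)⟩
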